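/- Let $A$ and $B$ be unital complex Banach algebras with units $1_A$, $1_B$, let $M$ be a unital Banach $A$-$B$-bimodule (with $\|am\|\le\|a\|\,\|m\|$ and $\|mb\|\le\|m\|\,\|b\|$), and let $$\mathcal T=\begin{bmatrix}A&M\\0&B\end{bmatrix}=\left\{\begin{bmatrix}a&m\\0&b\end{bmatrix}: a\in A,\ m\in M,\ b\in B\right\}$$ be the triangular Banach algebra, with the usual matrix operations and the norm $\|a\|+\|m\|+\|b\|$. Identify $a\in A$ and $b\in B$ with the diagonal elements $\begin{bmatrix}a&0\\0&0\end{bmatrix}$ and $\begin{bmatrix}0&0\\0&b\end{bmatrix}$ of $\mathcal T$. Let $X$ be a unital Banach $\mathcal T$-bimodule (with jointly continuous actions), and put $X_{AA}=1_AX1_A$, $X_{BB}=1_BX1_B$, $X_{BA}=1_BX1_A$; by restriction of the action, $X_{AA}$ is a unital Banach $A$-bimodule and $X_{BB}$ is a unital Banach $B$-bimodule. For a unital Banach algebra $D$ and a unital Banach $D$-bimodule $Y$, let $C_0(D,Y)=Y$ and $C_n(D,Y)=D\,\hat\otimes\cdots\hat\otimes\, D\,\hat\otimes\, Y$ ($n$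 copies of $D$, completed projective tensor product), and let $d_n:C_{n+1}(D,Y)\to C_n(D,Y)$ be the bounded linear operator with $$d_n(a_1\otimes\cdots\otimes a_{n+1}\otimes y)=a_2\otimes\cdots\otimes a_{n+1}\otimes ya_1+\sum_{k=1}^n(-1)^k a_1\otimes\cdots\otimes a_ka_{k+1}\otimes\cdots\otimes a_{n+1}\otimes y+(-1)^{n+1}a_1\otimes\cdots\otimes a_n\otimes a_{n+1}y .$$ Let $H_0(D,Y)=C_0(D,Y)/\operatorname{im}d_0$ and $H_n(D,Y)=\ker d_{n-1}/\operatorname{im}d_n$ for $n\ge1$ be the homology groups, seminormed spaces with the quotient seminorm. **Theorem.** If $X_{BA}=0$, then for all $n\ge0$ $$H_n(\mathcal T,X)\;\cong\;H_n(A,X_{AA})\oplus H_n(B,X_{BB})$$ as seminormed spaces, i.e. there is a linear bijection which is continuous with continuous inverse. -/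

import Mathlib

open scoped TensorProduct

universe u

noncomputable section

/-! ### Triangular algebras -/

/-- The `2 × 2` upper triangular matrices with diagonal entries `a ∈ A`, `b ∈ B` and
upper right corner `m ∈ M`. -/
@[ext]
structure TriangularAlgebra (A M B : Type*) where
  a : A
  m : M
  b : B

namespace TriangularAlgebra

section Additive

variable {A M B : Type*} [AddCommGroup A] [AddCommGroup M] [AddCommGroup B]

instance : Zero (TriangularAlgebra A M B) := ⟨⟨0, 0, 0⟩⟩
instance : Add (TriangularAlgebra A M B) := ⟨fun s t => ⟨s.a + t.a, s.m + t.m, s.b + t.b⟩⟩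
instance : Neg (TriangularAlgebra A M B) := ⟨fun s => ⟨-s.a, -s.m, -s.b⟩⟩
instance : Sub (TriangularAlgebra A M B) := ⟨fun s t => ⟨s.a - t.a, s.m - t.m, s.b - t.b⟩⟩

@[simp] lemma zero_a : (0 : TriangularAlgebra A M B).a = 0 := rfl
@[simp] lemma zero_m : (0 : TriangularAlgebra A M B).m = 0 := rfl
@[simp] lemma zero_b : (0 : TriangularAlgebra A M B).b = 0 := rfl
@[simp] lemma add_a (s t : TriangularAlgebra A M B) : (s + t).a = s.a + t.a := rfl
@[simp] lemma add_m (s t : TriangularAlgebra A M B) : (s + t).m = s.m + t.m := rfl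
@[simp] lemma add_b (s t : TriangularAlgebra A M B) : (s + t).b = s.b + t.b := rfl
@[simp] lemma neg_a (s : TriangularAlgebra A M B) : (-s).a = -s.a := rfl
@[simp] lemma neg_m (s : TriangularAlgebra A M B) : (-s).m = -s.m := rfl
@[simp] lemma neg_b (s : TriangularAlgebra A M B) : (-s).b = -s.b := rfl
@[simp] lemma sub_a (s t : TriangularAlgebra A M B) : (s - t).a = s.a - t.a := rfl
@[simp] lemma sub_m (s t : TriangularAlgebra A M B) : (s - t).m = s.m - t.m := rfl
@[simp] lemma sub_b (s t : TriangularAlgebra A M B) : (s - t).b = s.b - t.b := rfl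

end Additive

section SMul

variable {A M B R : Type*} [SMul R A] [SMul R M] [SMul R B]

instance : SMul R (TriangularAlgebra A M B) :=
  ⟨fun c s => ⟨c • s.a, c • s.m, c • s.b⟩⟩

@[simp] lemma smul_a (c : R) (s : TriangularAlgebra A M B) : (c • s).a = c • s.a := rfl
@[simp] lemma smul_m (c : R) (s : TriangularAlgebra A M B) : (c • s).m = c • s.m := rfl
@[simp] lemma smul_b (c : R) (s : TriangularAlgebra A M B) : (c • s).b = c • s.b := rfl

end SMul

instance {A M B : Type*} [AddCommGroup A] [AddCommGroup M] [AddCommGroup B] :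
    AddCommGroup (TriangularAlgebra A M B) where
  add_assoc _ _ _ := by ext <;> simp [add_assoc]
  zero_add _ := by ext <;> simp
  add_zero _ := by ext <;> simp
  add_comm _ _ := by ext <;> simp [add_comm]
  neg_add_cancel _ := by ext <;> simp
  sub_eq_add_neg _ _ := by ext <;> simp [sub_eq_add_neg]
  nsmul n t := n • t
  nsmul_zero _ := by ext <;> simp
  nsmul_succ _ _ := by ext <;> simp [succ_nsmul]
  zsmul n t := n • t
  zsmul_zero' _ := by ext <;> simp
  zsmul_succ' n t := by ext <;> simp [add_zsmul]
  zsmul_neg' n t := by ext <;> simp [Int.negSucc_eq, add_zsmul]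

section One

variable {A M B : Type*} [Ring A] [Ring B] [AddCommGroup M]

instance : One (TriangularAlgebra A M B) := ⟨⟨1, 0, 1⟩⟩

@[simp] lemma one_a : (1 : TriangularAlgebra A M B).a = 1 := rfl
@[simp] lemma one_m : (1 : TriangularAlgebra A M B).m = 0 := rfl
@[simp] lemma one_b : (1 : TriangularAlgebra A M B).b = 1 := rfl

end One

section Algebraic

variable {A M B : Type*} [Ring A] [Ring B] [AddCommGroup M] [Module A M] [Module Bᵐᵒᵖ M]

/-- Formal matrix multiplication; `MulOpposite.op b • m` is the right action `m b`. -/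
instance : Mul (TriangularAlgebra A M B) :=
  ⟨fun s t => ⟨s.a * t.a, s.a • t.m + MulOpposite.op t.b • s.m, s.b * t.b⟩⟩

@[simp] lemma mul_a (s t : TriangularAlgebra A M B) : (s * t).a = s.a * t.a := rfl
@[simp] lemma mul_m (s t : TriangularAlgebra A M B) :
    (s * t).m = s.a • t.m + MulOpposite.op t.b • s.m := rfl
@[simp] lemma mul_b (s t : TriangularAlgebra A M B) : (s * t).b = s.b * t.b := rfl

instance [SMulCommClass A Bᵐᵒᵖ M] : Ring (TriangularAlgebra A M B) where
  __ := (inferInstance : AddCommGroup (TriangularAlgebra A M B))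
  left_distrib _ _ _ := by ext <;> simp [mul_add, add_smul]; abel
  right_distrib _ _ _ := by ext <;> simp [add_mul, add_smul]; abel
  zero_mul _ := by ext <;> simp
  mul_zero _ := by ext <;> simp
  mul_assoc _ _ _ := by
    ext
    · simp [mul_assoc]
    · simp [mul_smul, smul_comm, add_assoc]
    · simp [mul_assoc]
  one_mul _ := by ext <;> simp
  mul_one _ := by ext <;> simp

end Algebraic

section Normed

variable {A M B : Type*} [NormedRing A] [NormedRing B] [NormedAddCommGroup M]

/-- The norm `‖a‖ + ‖m‖ + ‖b‖`. -/
instance : Norm (TriangularAlgebra A M B) := ⟨fun t => ‖t.a‖ + ‖t.m‖ + ‖t.b‖⟩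

lemma norm_def (t : TriangularAlgebra A M B) : ‖t‖ = ‖t.a‖ + ‖t.m‖ + ‖t.b‖ := rfl

instance : NormedAddCommGroup (TriangularAlgebra A M B) :=
  AddGroupNorm.toNormedAddCommGroup
    { toFun := fun t => ‖t‖
      map_zero' := by simp [norm_def]
      add_le' := fun s t => by
        have h₁ := norm_add_le s.a t.a
        have h₂ := norm_add_le s.m t.m
        have h₃ := norm_add_le s.b t.b
        simp only [norm_def, add_a, add_m, add_b]
        linarith
      neg' := fun t => by simp [norm_def]
      eq_zero_of_map_eq_zero' := fun t ht => by
        have h₁ := norm_nonneg t.a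
        have h₂ := norm_nonneg t.m
        have h₃ := norm_nonneg t.b
        simp only [norm_def] at ht
        ext
        · exact norm_eq_zero.1 (by linarith)
        · exact norm_eq_zero.1 (by linarith)
        · exact norm_eq_zero.1 (by linarith) }

variable [Module A M] [Module Bᵐᵒᵖ M]

instance [SMulCommClass A Bᵐᵒᵖ M] [IsBoundedSMul A M] [IsBoundedSMul Bᵐᵒᵖ M] :
    NormedRing (TriangularAlgebra A M B) where
  __ := (inferInstance : Ring (TriangularAlgebra A M B))
  __ := (inferInstance : NormedAddCommGroup (TriangularAlgebra A M B))
  norm_mul_le s t := by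
    have h₁ := norm_mul_le s.a t.a
    have h₂ := norm_add_le (s.a • t.m) (MulOpposite.op t.b • s.m)
    have h₃ := norm_smul_le s.a t.m
    have h₄ := norm_smul_le (MulOpposite.op t.b) s.m
    have h₅ := norm_mul_le s.b t.b
    rw [MulOpposite.norm_op] at h₄
    simp only [norm_def, mul_a, mul_m, mul_b]
    nlinarith [mul_nonneg (norm_nonneg s.a) (norm_nonneg t.b),
      mul_nonneg (norm_nonneg s.m) (norm_nonneg t.a),
      mul_nonneg (norm_nonneg s.m) (norm_nonneg t.m),
      mul_nonneg (norm_nonneg s.b) (norm_nonneg t.a),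
      mul_nonneg (norm_nonneg s.b) (norm_nonneg t.m)]

variable [NormedAlgebra ℂ A] [NormedAlgebra ℂ B] [NormedSpace ℂ M]

instance : Module ℂ (TriangularAlgebra A M B) where
  one_smul _ := by ext <;> simp
  mul_smul _ _ _ := by ext <;> simp [mul_smul]
  smul_zero _ := by ext <;> simp
  smul_add _ _ _ := by ext <;> simp
  add_smul _ _ _ := by ext <;> simp [add_smul]
  zero_smul _ := by ext <;> simp

variable [SMulCommClass A Bᵐᵒᵖ M]

variable (A M B) in
/-- The inclusion of `A` as the upper left corner; it maps the unit of `A` to the idempotent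
written `1_A` in `1_A X 1_A`. -/
def inclA : A →ₙₐ[ℂ] TriangularAlgebra A M B where
  toFun a := ⟨a, 0, 0⟩
  map_smul' c a := by ext <;> simp
  map_zero' := rfl
  map_add' a a' := by ext <;> simp
  map_mul' a a' := by ext <;> simp

variable (A M B) in
/-- The inclusion of `B` as the lower right corner; it maps the unit of `B` to the idempotent
written `1_B` in `1_B X 1_B`. -/
def inclB : B →ₙₐ[ℂ] TriangularAlgebra A M B where
  toFun b := ⟨0, 0, b⟩
  map_smul' c b := by ext <;> simp
  map_zero' := rfl
  map_add' b b' := by ext <;> simp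
  map_mul' b b' := by ext <;> simp

variable (A M B) in
lemma continuous_inclA : Continuous (inclA A M B) :=
  AddMonoidHomClass.continuous_of_bound (inclA A M B) 1 fun a => by simp [norm_def, inclA]

variable (A M B) in
lemma continuous_inclB : Continuous (inclB A M B) :=
  AddMonoidHomClass.continuous_of_bound (inclB A M B) 1 fun b => by simp [norm_def, inclB]

variable [IsScalarTower ℂ A M] [IsScalarTower ℂ Bᵐᵒᵖ M]

instance : Algebra ℂ (TriangularAlgebra A M B) :=
  Algebra.ofModule
    (fun c s t => by ext <;> simp [smul_comm c])
    (fun c s t => by ext <;> simp [smul_comm c])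

instance [IsBoundedSMul A M] [IsBoundedSMul Bᵐᵒᵖ M] :
    NormedAlgebra ℂ (TriangularAlgebra A M B) where
  __ := (inferInstance : Algebra ℂ (TriangularAlgebra A M B))
  norm_smul_le c t := by
    simp only [norm_def, smul_a, smul_m, smul_b, norm_smul]
    exact le_of_eq (by ring)

end Normed

end TriangularAlgebra

/-! ### The corners `p X q` of a bimodule -/

section Corner

/-- `p X q = {p x q : x ∈ X}`, for a bimodule `X` over `T` and `p q : T`. -/
def cornerSpace {T : Type*} (X : Type*) [NormedRing T] [NormedAlgebra ℂ T]
    [NormedAddCommGroup X] [NormedSpace ℂ X] [Module T X] [Module Tᵐᵒᵖ X]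
    [IsScalarTower ℂ T X] [IsScalarTower ℂ Tᵐᵒᵖ X] (p q : T) : Submodule ℂ X where
  carrier := Set.range fun x : X => p • MulOpposite.op q • x
  zero_mem' := ⟨0, by simp⟩
  add_mem' := by
    rintro _ _ ⟨x, rfl⟩ ⟨y, rfl⟩
    exact ⟨x + y, by simp⟩
  smul_mem' := by
    rintro c _ ⟨x, rfl⟩
    exact ⟨c • x, by simp [smul_comm _ c]⟩

variable {A T X : Type*} [NormedRing A] [NormedAlgebra ℂ A] [NormedRing T] [NormedAlgebra ℂ T]
    [NormedAddCommGroup X] [NormedSpace ℂ X] [Module T X] [Module Tᵐᵒᵖ X]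
    [IsScalarTower ℂ T X] [IsScalarTower ℂ Tᵐᵒᵖ X] (j : A →ₙₐ[ℂ] T)

lemma cornerSpace_one_smul {x : X} (hx : x ∈ cornerSpace X (j 1) (j 1)) : j 1 • x = x := by
  obtain ⟨y, rfl⟩ := hx
  simp only [smul_smul, ← map_mul, one_mul]

variable [SMulCommClass T Tᵐᵒᵖ X]

lemma cornerSpace_smul_mem (a : A) {x : X} (hx : x ∈ cornerSpace X (j 1) (j 1)) :
    j a • x ∈ cornerSpace X (j 1) (j 1) := by
  obtain ⟨y, rfl⟩ := hx
  refine ⟨j a • y, ?_⟩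
  have h : j 1 * j a = j a * j 1 := by rw [← map_mul, ← map_mul, one_mul, mul_one]
  simp only [← smul_comm (j a) (MulOpposite.op (j 1)) y, smul_smul, h]

lemma cornerSpace_op_smul_mem (a : A) {x : X} (hx : x ∈ cornerSpace X (j 1) (j 1)) :
    MulOpposite.op (j a) • x ∈ cornerSpace X (j 1) (j 1) := by
  obtain ⟨y, rfl⟩ := hx
  refine ⟨MulOpposite.op (j a) • y, ?_⟩
  have h : j a * j 1 = j 1 * j a := by rw [← map_mul, ← map_mul, one_mul, mul_one]
  simp only [← smul_comm (j 1) (MulOpposite.op (j a)), smul_smul, ← MulOpposite.op_mul, h]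

lemma cornerSpace_op_one_smul {x : X} (hx : x ∈ cornerSpace X (j 1) (j 1)) :
    MulOpposite.op (j 1) • x = x := by
  obtain ⟨y, rfl⟩ := hx
  simp only [← smul_comm (j 1) (MulOpposite.op (j 1)), smul_smul, ← map_mul, one_mul,
    ← MulOpposite.op_mul]

/-- For `j : A → T` multiplicative and `p = j 1`, the left `A`-module `p X p`, `a x = j(a) x`. -/
abbrev cornerModule : Module A (cornerSpace X (j 1) (j 1)) where
  smul a x := ⟨j a • (x : X), cornerSpace_smul_mem j a x.2⟩
  one_smul x := Subtype.ext (cornerSpace_one_smul j x.2)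
  mul_smul a b x := Subtype.ext (by
    change j (a * b) • (x : X) = j a • j b • (x : X)
    rw [map_mul, mul_smul])
  smul_zero a := Subtype.ext (smul_zero (j a))
  smul_add a x y := Subtype.ext (smul_add (j a) (x : X) (y : X))
  add_smul a b x := Subtype.ext (by
    change j (a + b) • (x : X) = j a • (x : X) + j b • (x : X)
    rw [map_add, add_smul])
  zero_smul x := Subtype.ext (by
    change j 0 • (x : X) = 0
    rw [map_zero, zero_smul])

/-- For `j : A → T` multiplicative and `p = j 1`, the right `A`-module `p X p`, `x a = x j(a)`. -/
abbrev cornerModuleOp : Module Aᵐᵒᵖ (cornerSpace X (j 1) (j 1)) where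
  smul a x := ⟨MulOpposite.op (j a.unop) • (x : X), cornerSpace_op_smul_mem j a.unop x.2⟩
  one_smul x := Subtype.ext (cornerSpace_op_one_smul j x.2)
  mul_smul a b x := Subtype.ext (by
    change MulOpposite.op (j (a * b).unop) • (x : X) =
      MulOpposite.op (j a.unop) • MulOpposite.op (j b.unop) • (x : X)
    rw [MulOpposite.unop_mul, map_mul, MulOpposite.op_mul, mul_smul])
  smul_zero a := Subtype.ext (smul_zero (MulOpposite.op (j a.unop)))
  smul_add a x y := Subtype.ext (smul_add (MulOpposite.op (j a.unop)) (x : X) (y : X))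
  add_smul a b x := Subtype.ext (by
    change MulOpposite.op (j (a + b).unop) • (x : X) =
      MulOpposite.op (j a.unop) • (x : X) + MulOpposite.op (j b.unop) • (x : X)
    rw [MulOpposite.unop_add, map_add, MulOpposite.op_add, add_smul])
  zero_smul x := Subtype.ext (by
    change MulOpposite.op (j (0 : Aᵐᵒᵖ).unop) • (x : X) = 0
    rw [MulOpposite.unop_zero, map_zero, MulOpposite.op_zero, zero_smul])

end Corner

section Corners

open TriangularAlgebra

variable (A M B X : Type*)
  [NormedRing A] [NormedAlgebra ℂ A] [NormedRing B] [NormedAlgebra ℂ B]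
  [NormedAddCommGroup M] [NormedSpace ℂ M] [Module A M] [Module Bᵐᵒᵖ M]
  [SMulCommClass A Bᵐᵒᵖ M] [IsScalarTower ℂ A M] [IsScalarTower ℂ Bᵐᵒᵖ M]
  [IsBoundedSMul A M] [IsBoundedSMul Bᵐᵒᵖ M]
  [NormedAddCommGroup X] [NormedSpace ℂ X]
  [Module (TriangularAlgebra A M B) X] [Module (TriangularAlgebra A M B)ᵐᵒᵖ X]
  [IsScalarTower ℂ (TriangularAlgebra A M B) X]
  [IsScalarTower ℂ (TriangularAlgebra A M B)ᵐᵒᵖ X]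

/-- `X_AA = 1_A X 1_A`. -/
def cornerAA : Submodule ℂ X := cornerSpace X (inclA A M B 1) (inclA A M B 1)

/-- `X_BB = 1_B X 1_B`. -/
def cornerBB : Submodule ℂ X := cornerSpace X (inclB A M B 1) (inclB A M B 1)

/-- `X_BA = 1_B X 1_A`. -/
def cornerBA : Submodule ℂ X := cornerSpace X (inclB A M B 1) (inclA A M B 1)

variable [SMulCommClass (TriangularAlgebra A M B) (TriangularAlgebra A M B)ᵐᵒᵖ X]

instance : Module A (cornerAA A M B X) := cornerModule (inclA A M B)
instance : Module Aᵐᵒᵖ (cornerAA A M B X) := cornerModuleOp (inclA A M B)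
instance : Module B (cornerBB A M B X) := cornerModule (inclB A M B)
instance : Module Bᵐᵒᵖ (cornerBB A M B X) := cornerModuleOp (inclB A M B)

variable {A M B X}

lemma coe_smul_cornerAA (a : A) (x : cornerAA A M B X) :
    ((a • x : cornerAA A M B X) : X) = inclA A M B a • (x : X) := rfl
lemma coe_op_smul_cornerAA (a : Aᵐᵒᵖ) (x : cornerAA A M B X) :
    ((a • x : cornerAA A M B X) : X) = MulOpposite.op (inclA A M B a.unop) • (x : X) := rfl
lemma coe_smul_cornerBB (b : B) (x : cornerBB A M B X) :
    ((b • x : cornerBB A M B X) : X) = inclB A M B b • (x : X) := rfl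
lemma coe_op_smul_cornerBB (b : Bᵐᵒᵖ) (x : cornerBB A M B X) :
    ((b • x : cornerBB A M B X) : X) = MulOpposite.op (inclB A M B b.unop) • (x : X) := rfl

instance : SMulCommClass A Aᵐᵒᵖ (cornerAA A M B X) :=
  ⟨fun _ _ _ => Subtype.ext (smul_comm _ _ _)⟩
instance : SMulCommClass B Bᵐᵒᵖ (cornerBB A M B X) :=
  ⟨fun _ _ _ => Subtype.ext (smul_comm _ _ _)⟩
instance : IsScalarTower ℂ A (cornerAA A M B X) :=
  ⟨fun c a x => Subtype.ext (by
    simp only [coe_smul_cornerAA, Submodule.coe_smul, map_smul, smul_assoc])⟩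
instance : IsScalarTower ℂ B (cornerBB A M B X) :=
  ⟨fun c a x => Subtype.ext (by
    simp only [coe_smul_cornerBB, Submodule.coe_smul, map_smul, smul_assoc])⟩
instance : IsScalarTower ℂ Aᵐᵒᵖ (cornerAA A M B X) :=
  ⟨fun c a x => Subtype.ext (by
    simp only [coe_op_smul_cornerAA, Submodule.coe_smul, MulOpposite.unop_smul, map_smul,
      MulOpposite.op_smul, smul_assoc])⟩
instance : IsScalarTower ℂ Bᵐᵒᵖ (cornerBB A M B X) :=
  ⟨fun c a x => Subtype.ext (by
    simp only [coe_op_smul_cornerBB, Submodule.coe_smul, MulOpposite.unop_smul, map_smul,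
      MulOpposite.op_smul, smul_assoc])⟩

instance [ContinuousSMul (TriangularAlgebra A M B) X] :
    ContinuousSMul A (cornerAA A M B X) :=
  ⟨Continuous.subtype_mk (((continuous_inclA A M B).comp continuous_fst).smul
    (continuous_subtype_val.comp continuous_snd)) _⟩
instance [ContinuousSMul (TriangularAlgebra A M B) X] :
    ContinuousSMul B (cornerBB A M B X) :=
  ⟨Continuous.subtype_mk (((continuous_inclB A M B).comp continuous_fst).smul
    (continuous_subtype_val.comp continuous_snd)) _⟩
instance [ContinuousSMul (TriangularAlgebra A M B)ᵐᵒᵖ X] :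
    ContinuousSMul Aᵐᵒᵖ (cornerAA A M B X) :=
  ⟨Continuous.subtype_mk ((MulOpposite.continuous_op.comp
    ((continuous_inclA A M B).comp (MulOpposite.continuous_unop.comp continuous_fst))).smul
    (continuous_subtype_val.comp continuous_snd)) _⟩
instance [ContinuousSMul (TriangularAlgebra A M B)ᵐᵒᵖ X] :
    ContinuousSMul Bᵐᵒᵖ (cornerBB A M B X) :=
  ⟨Continuous.subtype_mk ((MulOpposite.continuous_op.comp
    ((continuous_inclB A M B).comp (MulOpposite.continuous_unop.comp continuous_fst))).smul
    (continuous_subtype_val.comp continuous_snd)) _⟩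

end Corners

/-! ### Homology of a Banach algebra with coefficients in a Banach bimodule -/

section Homology

variable (A X : Type u)

/-- The factors of `A ⊗ ⋯ ⊗ A ⊗ X` (`n` copies of `A`): the index `none` carries `X`, and the
index `some i` carries the `i`-th copy of `A`. -/
def ChainFactor (n : ℕ) : Option (Fin n) → Type u
  | none => X
  | some _ => A

instance (n : ℕ) [NormedAddCommGroup A] [NormedAddCommGroup X] :
    ∀ i, NormedAddCommGroup (ChainFactor A X n i)
  | none => inferInstanceAs (NormedAddCommGroup X)
  | some _ => inferInstanceAs (NormedAddCommGroup A)

instance (n : ℕ) [NormedAddCommGroup A] [NormedAddCommGroup X] [NormedSpace ℂ A]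
    [NormedSpace ℂ X] : ∀ i, NormedSpace ℂ (ChainFactor A X n i)
  | none => inferInstanceAs (NormedSpace ℂ X)
  | some _ => inferInstanceAs (NormedSpace ℂ A)

variable {A X}

/-- The tuple `(a_1, …, a_n, x)`. -/
def chainTuple {n : ℕ} (a : Fin n → A) (x : X) : ∀ i, ChainFactor A X n i
  | none => x
  | some i => a i

/-- The entries `a_1, …, a_n` of a tuple `(a_1, …, a_n, x)`. -/
def algPart {n : ℕ} (v : ∀ i, ChainFactor A X n i) : Fin n → A := fun i => v (some i)

/-- The entry `x` of a tuple `(a_1, …, a_n, x)`. -/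
def modPart {n : ℕ} (v : ∀ i, ChainFactor A X n i) : X := v none

lemma algPart_update_none {n : ℕ} (v : ∀ i, ChainFactor A X n i) (x : X) :
    algPart (Function.update v none x) = algPart v := by
  funext i
  exact Function.update_of_ne (by simp) _ _

lemma modPart_update_none {n : ℕ} (v : ∀ i, ChainFactor A X n i) (x : X) :
    modPart (Function.update v none x) = x :=
  Function.update_self _ _ _

lemma algPart_update_some {n : ℕ} (v : ∀ i, ChainFactor A X n i) (i : Fin n) (a : A) :
    algPart (Function.update v (some i) a) = Function.update (algPart v) i a := by
  funext k
  by_cases h : k = i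
  · subst h
    rw [Function.update_self]
    exact Function.update_self _ _ _
  · rw [Function.update_of_ne h]
    exact Function.update_of_ne (by simpa using h) _ _

lemma modPart_update_some {n : ℕ} (v : ∀ i, ChainFactor A X n i) (i : Fin n) (a : A) :
    modPart (Function.update v (some i) a) = modPart v :=
  Function.update_of_ne (by simp) _ _

lemma chainTuple_update_some {n : ℕ} (a : Fin n → A) (x : X) (i : Fin n) (b : A) :
    chainTuple (Function.update a i b) x =
      Function.update (β := ChainFactor A X n) (chainTuple a x) (some i) b := by
  funext k
  rcases k with _ | k
  · exact (Function.update_of_ne (by simp) _ _).symm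
  · change Function.update a i b k = _
    by_cases h : k = i
    · subst h
      rw [Function.update_self]
      exact (Function.update_self (β := ChainFactor A X n) (some k) b (chainTuple a x)).symm
    · rw [Function.update_of_ne h]
      exact (Function.update_of_ne (β := ChainFactor A X n) (a := some k) (a' := some i)
        (by simpa using h) b (chainTuple a x)).symm

lemma chainTuple_update_none {n : ℕ} (a : Fin n → A) (x y : X) :
    chainTuple a y = Function.update (β := ChainFactor A X n) (chainTuple a x) none y := by
  funext k
  rcases k with _ | k
  · exact (Function.update_self (β := ChainFactor A X n) none y (chainTuple a x)).symm
  · exact (Function.update_of_ne (β := ChainFactor A X n) (a' := none) (a := some k) (by simp) y (chainTuple a x)).symm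

section Continuity

variable [NormedAddCommGroup A] [NormedAddCommGroup X]

lemma continuous_algPart {n : ℕ} :
    Continuous fun v : ∀ i, ChainFactor A X n i => algPart v :=
  continuous_pi fun i => continuous_apply (A := ChainFactor A X n) (some i)

lemma continuous_modPart {n : ℕ} :
    Continuous fun v : ∀ i, ChainFactor A X n i => modPart v :=
  continuous_apply (A := ChainFactor A X n) none

lemma continuous_chainTuple {n : ℕ} :
    Continuous fun p : (Fin n → A) × X => chainTuple p.1 p.2 := by
  refine continuous_pi fun i => ?_
  rcases i with _ | i
  · exact continuous_snd
  · exact (continuous_apply i).comp continuous_fst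

end Continuity

section Faces

variable [NormedAddCommGroup A] [NormedSpace ℂ A] [NormedAddCommGroup X] [NormedSpace ℂ X]

/-- The elementary tensor `a_1 ⊗ ⋯ ⊗ a_n ⊗ x`. -/
def pureChain {n : ℕ} (a : Fin n → A) (x : X) : ⨂[ℂ] i, ChainFactor A X n i :=
  PiTensorProduct.tprodL ℂ (chainTuple a x)

lemma pureChain_add {n : ℕ} (a : Fin n → A) (x y : X) :
    pureChain a (x + y) = pureChain a x + pureChain a y := by
  unfold pureChain
  rw [chainTuple_update_none a 0 (x + y), chainTuple_update_none a 0 x,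
    chainTuple_update_none a 0 y]
  exact (PiTensorProduct.tprodL ℂ).map_update_add (chainTuple a (0 : X)) none x y

lemma pureChain_smul {n : ℕ} (a : Fin n → A) (c : ℂ) (x : X) :
    pureChain a (c • x) = c • pureChain a x := by
  unfold pureChain
  rw [chainTuple_update_none a 0 (c • x), chainTuple_update_none a 0 x]
  exact (PiTensorProduct.tprodL ℂ).map_update_smul (chainTuple a (0 : X)) none c x

lemma pureChain_update_add {n : ℕ} (a : Fin n → A) (i : Fin n) (b c : A) (x : X) :
    pureChain (Function.update a i (b + c)) x =
      pureChain (Function.update a i b) x + pureChain (Function.update a i c) x := by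
  unfold pureChain
  rw [chainTuple_update_some, chainTuple_update_some, chainTuple_update_some]
  exact (PiTensorProduct.tprodL ℂ).map_update_add (chainTuple a x) (some i) b c

lemma pureChain_update_smul {n : ℕ} (a : Fin n → A) (i : Fin n) (c : ℂ) (b : A) (x : X) :
    pureChain (Function.update a i (c • b)) x = c • pureChain (Function.update a i b) x := by
  unfold pureChain
  rw [chainTuple_update_some, chainTuple_update_some]
  exact (PiTensorProduct.tprodL ℂ).map_update_smul (chainTuple a x) (some i) c b

/-- The continuous multilinear map `(a, x) ↦ F(a) ⊗ G(a, x)`. The hypotheses say that `G` is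
linear in `x`, and that each entry of `a` enters, linearly, either exactly one entry of `F` and
not `G`, or `G` and no entry of `F`. -/
def faceMap {n k : ℕ} (F : (Fin k → A) → Fin n → A) (G : (Fin k → A) → X → X)
    (hX : ∀ a, IsLinearMap ℂ (G a))
    (hA : ∀ a i,
      (∃ (i' : Fin n) (L : A →ₗ[ℂ] A), ∀ y, F (Function.update a i y) =
          Function.update (F a) i' (L y) ∧ ∀ x, G (Function.update a i y) x = G a x) ∨
      (∃ L : X → A →ₗ[ℂ] X, ∀ y, F (Function.update a i y) = F a ∧
          ∀ x, G (Function.update a i y) x = L x y))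
    (hF : Continuous F) (hG : Continuous fun p : (Fin k → A) × X => G p.1 p.2) :
    ContinuousMultilinearMap ℂ (ChainFactor A X k) (⨂[ℂ] i, ChainFactor A X n i) where
  toFun v := pureChain (F (algPart v)) (G (algPart v) (modPart v))
  map_update_add' {inst} v i y z := by
    obtain rfl : inst = Option.instDecidableEq := Subsingleton.elim _ _
    rcases i with _ | i
    · have key : ∀ y : X, pureChain (F (algPart (Function.update v none y)))
          (G (algPart (Function.update v none y)) (modPart (Function.update v none y))) =
          pureChain (F (algPart v)) (G (algPart v) y) := fun y => by
        rw [algPart_update_none, modPart_update_none]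
      refine (key _).trans (Eq.trans ?_ (congrArg₂ (· + ·) (key y) (key z)).symm)
      exact (congrArg _ ((hX _).map_add y z)).trans (pureChain_add _ _ _)
    · have key : ∀ y : A, pureChain (F (algPart (Function.update v (some i) y)))
          (G (algPart (Function.update v (some i) y)) (modPart (Function.update v (some i) y))) =
          pureChain (F (Function.update (algPart v) i y))
            (G (Function.update (algPart v) i y) (modPart v)) := fun y => by
        rw [algPart_update_some, modPart_update_some]
      refine (key _).trans (Eq.trans ?_ (congrArg₂ (· + ·) (key y) (key z)).symm)
      rcases hA (algPart v) i with ⟨i', L, h⟩ | ⟨L, h⟩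
      · have key₂ : ∀ y z : A, pureChain (F (Function.update (algPart v) i (y + z)))
            (G (Function.update (algPart v) i (y + z)) (modPart v)) =
            pureChain (F (Function.update (algPart v) i y))
              (G (Function.update (algPart v) i y) (modPart v)) +
            pureChain (F (Function.update (algPart v) i z))
              (G (Function.update (algPart v) i z) (modPart v)) := fun y z => by
          simp only [(h _).1, (h _).2, map_add, pureChain_update_add]
        exact key₂ y z
      · have key₂ : ∀ y z : A, pureChain (F (Function.update (algPart v) i (y + z)))
            (G (Function.update (algPart v) i (y + z)) (modPart v)) =
            pureChain (F (Function.update (algPart v) i y))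
              (G (Function.update (algPart v) i y) (modPart v)) +
            pureChain (F (Function.update (algPart v) i z))
              (G (Function.update (algPart v) i z) (modPart v)) := fun y z => by
          simp only [(h _).1, (h _).2, map_add, pureChain_add]
        exact key₂ y z
  map_update_smul' {inst} v i c y := by
    obtain rfl : inst = Option.instDecidableEq := Subsingleton.elim _ _
    rcases i with _ | i
    · have key : ∀ y : X, pureChain (F (algPart (Function.update v none y)))
          (G (algPart (Function.update v none y)) (modPart (Function.update v none y))) =
          pureChain (F (algPart v)) (G (algPart v) y) := fun y => by
        rw [algPart_update_none, modPart_update_none]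
      refine (key _).trans (Eq.trans ?_ (congrArg (c • ·) (key y)).symm)
      exact (congrArg _ ((hX _).map_smul c y)).trans (pureChain_smul _ _ _)
    · have key : ∀ y : A, pureChain (F (algPart (Function.update v (some i) y)))
          (G (algPart (Function.update v (some i) y)) (modPart (Function.update v (some i) y))) =
          pureChain (F (Function.update (algPart v) i y))
            (G (Function.update (algPart v) i y) (modPart v)) := fun y => by
        rw [algPart_update_some, modPart_update_some]
      refine (key _).trans (Eq.trans ?_ (congrArg (c • ·) (key y)).symm)
      have key₂ : ∀ y : A, pureChain (F (Function.update (algPart v) i (c • y)))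
          (G (Function.update (algPart v) i (c • y)) (modPart v)) =
          c • pureChain (F (Function.update (algPart v) i y))
            (G (Function.update (algPart v) i y) (modPart v)) := fun y => by
        rcases hA (algPart v) i with ⟨i', L, h⟩ | ⟨L, h⟩
        · simp only [(h _).1, (h _).2, map_smul, pureChain_update_smul]
        · simp only [(h _).1, (h _).2, map_smul, pureChain_smul]
      exact key₂ y
  cont := (PiTensorProduct.tprodL ℂ).cont.comp (continuous_chainTuple.comp
    ((hF.comp continuous_algPart).prodMk
      (hG.comp (continuous_algPart.prodMk continuous_modPart))))

end Faces

section Differential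

variable [NormedRing A] [NormedAlgebra ℂ A]

lemma contractNth_update {n : ℕ} (j : Fin n) (a : Fin (n + 1) → A) (i : Fin (n + 1)) :
    ∃ (i' : Fin n) (L : A →ₗ[ℂ] A), ∀ y,
      Fin.contractNth j.castSucc (· * ·) (Function.update a i y) =
        Function.update (Fin.contractNth j.castSucc (· * ·) a) i' (L y) := by
  rcases lt_trichotomy (i : ℕ) j with h | h | h
  · refine ⟨⟨i, by omega⟩, LinearMap.id, fun y => ?_⟩
    funext k
    simp only [Fin.contractNth, Function.update_apply, Fin.ext_iff, Fin.val_castSucc, Fin.val_succ,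
      LinearMap.id_apply]
    split_ifs <;> first | rfl | omega
  · refine ⟨j, LinearMap.mulRight ℂ (a j.succ), fun y => ?_⟩
    funext k
    simp only [Fin.contractNth, Function.update_apply, Fin.ext_iff, Fin.val_castSucc, Fin.val_succ,
      LinearMap.mulRight_apply]
    split_ifs with h₁ h₂ h₃ h₄ h₅ <;> first | rfl | omega | skip
    obtain rfl : k = j := Fin.ext (by omega)
    rfl
  · by_cases h' : (i : ℕ) = j + 1
    · refine ⟨j, LinearMap.mulLeft ℂ (a j.castSucc), fun y => ?_⟩
      funext k
      simp only [Fin.contractNth, Function.update_apply, Fin.ext_iff, Fin.val_castSucc,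
        Fin.val_succ, LinearMap.mulLeft_apply]
      split_ifs with h₁ h₂ h₃ h₄ h₅ <;> first | rfl | omega | skip
      obtain rfl : k = j := Fin.ext (by omega)
      rfl
    · refine ⟨⟨i - 1, by omega⟩, LinearMap.id, fun y => ?_⟩
      funext k
      simp only [Fin.contractNth, Function.update_apply, Fin.ext_iff, Fin.val_castSucc,
        Fin.val_succ, LinearMap.id_apply]
      split_ifs <;> first | rfl | omega

variable [NormedAddCommGroup X] [NormedSpace ℂ X]
  [Module A X] [Module Aᵐᵒᵖ X] [IsScalarTower ℂ A X] [IsScalarTower ℂ Aᵐᵒᵖ X]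
  [ContinuousSMul A X] [ContinuousSMul Aᵐᵒᵖ X]

variable (A X) in
/-- `(a_1, …, a_{n+1}, x) ↦ a_2 ⊗ ⋯ ⊗ a_{n+1} ⊗ x a_1`. -/
def firstFace (n : ℕ) :
    ContinuousMultilinearMap ℂ (ChainFactor A X (n + 1)) (⨂[ℂ] i, ChainFactor A X n i) :=
  faceMap (fun a => Fin.tail a) (fun a x => MulOpposite.op (a 0) • x)
    (fun a => (DistribSMul.toLinearMap ℂ X (MulOpposite.op (a 0))).isLinear)
    (fun a i => by
      refine Fin.cases ?_ (fun i => ?_) i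
      · refine Or.inr ⟨fun x => (LinearMap.toSpanSingleton Aᵐᵒᵖ X x).restrictScalars ℂ ∘ₗ
          (MulOpposite.opLinearEquiv ℂ).toLinearMap, fun y => ⟨?_, fun x => ?_⟩⟩
        · rw [Fin.tail_update_zero]
        · rw [Function.update_self]
          rfl
      · refine Or.inl ⟨i, LinearMap.id, fun y => ⟨?_, fun x => ?_⟩⟩
        · rw [Fin.tail_update_succ]
          rfl
        · rw [Function.update_of_ne (Fin.succ_ne_zero i).symm])
    (continuous_pi fun i => continuous_apply _)
    ((MulOpposite.continuous_op.comp ((continuous_apply 0).comp continuous_fst)).smul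
      continuous_snd)

variable (A X) in
/-- `(a_1, …, a_{n+1}, x) ↦ a_1 ⊗ ⋯ ⊗ a_{j+1} a_{j+2} ⊗ ⋯ ⊗ a_{n+1} ⊗ x`, for `0 ≤ j < n`. -/
def midFace (n : ℕ) (j : Fin n) :
    ContinuousMultilinearMap ℂ (ChainFactor A X (n + 1)) (⨂[ℂ] i, ChainFactor A X n i) :=
  faceMap (fun a => Fin.contractNth j.castSucc (· * ·) a) (fun _ x => x)
    (fun _ => LinearMap.id.isLinear)
    (fun a i => by
      obtain ⟨i', L, h⟩ := contractNth_update j a i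
      exact Or.inl ⟨i', L, fun y => ⟨h y, fun x => rfl⟩⟩)
    (continuous_pi fun i => by
      unfold Fin.contractNth
      split_ifs
      · exact continuous_apply _
      · exact (continuous_apply _).mul (continuous_apply _)
      · exact continuous_apply _)
    continuous_snd

variable (A X) in
/-- `(a_1, …, a_{n+1}, x) ↦ a_1 ⊗ ⋯ ⊗ a_n ⊗ a_{n+1} x`. -/
def lastFace (n : ℕ) :
    ContinuousMultilinearMap ℂ (ChainFactor A X (n + 1)) (⨂[ℂ] i, ChainFactor A X n i) :=
  faceMap (fun a => Fin.init a) (fun a x => a (Fin.last n) • x)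
    (fun a => (DistribSMul.toLinearMap ℂ X (a (Fin.last n))).isLinear)
    (fun a i => by
      refine Fin.lastCases ?_ (fun i => ?_) i
      · refine Or.inr ⟨fun x => (LinearMap.toSpanSingleton A X x).restrictScalars ℂ,
          fun y => ⟨?_, fun x => ?_⟩⟩
        · rw [Fin.init_update_last]
        · rw [Function.update_self]
          rfl
      · refine Or.inl ⟨i, LinearMap.id, fun y => ⟨?_, fun x => ?_⟩⟩
        · rw [Fin.init_update_castSucc]
          rfl
        · rw [Function.update_of_ne (Fin.castSucc_lt_last i).ne'])
    (continuous_pi fun i => continuous_apply _)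
    (((continuous_apply (Fin.last n)).comp continuous_fst).smul continuous_snd)

variable (A X) in
/-- The space of `n`-chains `A ⊗̂ ⋯ ⊗̂ A ⊗̂ X` (`n` copies of `A`): the completion of the algebraic
tensor product for the projective tensor norm. -/
abbrev Chains (n : ℕ) : Type u :=
  UniformSpace.Completion (⨂[ℂ] i, ChainFactor A X n i)

variable (A X) in
/-- The boundary operator `d_n : C_{n+1}(A, X) → C_n(A, X)`,
`d_n (a_1 ⊗ ⋯ ⊗ a_{n+1} ⊗ x) = a_2 ⊗ ⋯ ⊗ a_{n+1} ⊗ x a_1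
  + ∑_{k=1}^n (-1)^k a_1 ⊗ ⋯ ⊗ a_k a_{k+1} ⊗ ⋯ ⊗ a_{n+1} ⊗ x
  + (-1)^{n+1} a_1 ⊗ ⋯ ⊗ a_n ⊗ a_{n+1} x`. -/
def boundary (n : ℕ) : Chains A X (n + 1) →L[ℂ] Chains A X n :=
  (PiTensorProduct.liftIsometry ℂ (ChainFactor A X (n + 1)) _
    (firstFace A X n + ∑ j : Fin n, (-1 : ℂ) ^ ((j : ℕ) + 1) • midFace A X n j
      + (-1 : ℂ) ^ (n + 1) • lastFace A X n)).completion

variable (A X) in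
/-- The `n`-cycles: `C_0` for `n = 0`, and the kernel of `d_{n-1}` for `n ≥ 1`. -/
def cycles : (n : ℕ) → Submodule ℂ (Chains A X n)
  | 0 => ⊤
  | n + 1 => LinearMap.ker (boundary A X n).toLinearMap

variable (A X) in
/-- The `n`-boundaries, i.e. the range of `d_n`. -/
def boundaries (n : ℕ) : Submodule ℂ (Chains A X n) :=
  LinearMap.range (boundary A X n).toLinearMap

end Differential

/-- The homology group `H_n(A, X)` of a unital Banach algebra `A` with coefficients in a unital
Banach `A`-bimodule `X`: cycles modulo (not necessarily closed) boundaries, with the quotient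
seminorm. -/
abbrev BanachHomology (A X : Type u)
    [NormedRing A] [NormedAlgebra ℂ A] [NormedAddCommGroup X] [NormedSpace ℂ X]
    [Module A X] [Module Aᵐᵒᵖ X] [SMulCommClass A Aᵐᵒᵖ X]
    [IsScalarTower ℂ A X] [IsScalarTower ℂ Aᵐᵒᵖ X]
    [ContinuousSMul A X] [ContinuousSMul Aᵐᵒᵖ X] (n : ℕ) : Type u :=
  cycles A X n ⧸ (boundaries A X n).submoduleOf (cycles A X n)

end Homology

end

noncomputable section

/-! ### Alternating double sums -/

section AlternatingSums

variable {V : Type*} [AddCommGroup V] [Module ℂ V]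

lemma sum_sum_alternating_eq_zero (n : ℕ) (S : ℕ → ℕ → V)
    (h : ∀ i j, i < j → j ≤ n + 2 → S i j = S (j - 1) i) :
    ∑ j ∈ Finset.range (n + 3), ∑ i ∈ Finset.range (n + 2), (-1 : ℂ) ^ (i + j) • S i j = 0 := by
  rw [← Finset.sum_product']
  refine Finset.sum_involution
    (fun p _ => if p.2 < p.1 then (p.2, p.1 - 1) else (p.2 + 1, p.1)) ?_ ?_ ?_ ?_
  · rintro ⟨j, i⟩ hp
    simp only [Finset.mem_product, Finset.mem_range] at hp
    dsimp only
    split_ifs with hij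
    · rw [h i j hij (by omega)]
      obtain ⟨j, rfl⟩ := Nat.exists_eq_add_of_lt hij
      simp only [Nat.add_sub_cancel]
      rw [show i + (i + j + 1) = (i + j + i) + 1 by omega, pow_succ]
      simp
    · dsimp only
      rw [h j (i + 1) (by omega) (by omega), Nat.add_sub_cancel,
        show j + (i + 1) = (i + j) + 1 by omega, pow_succ]
      simp
  · rintro ⟨j, i⟩ hp _ h'
    dsimp only at h'
    split_ifs at h' with hij <;> simp only [Prod.mk.injEq] at h' <;> omega
  · rintro ⟨j, i⟩ hp
    simp only [Finset.mem_product, Finset.mem_range] at hp ⊢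
    split_ifs <;> constructor <;> dsimp only <;> omega
  · rintro ⟨j, i⟩ hp
    by_cases hij : i < j
    · have h' : ¬ j - 1 < i := by omega
      simp only [hij, h', if_true, if_false, Prod.mk.injEq, and_true]
      omega
    · have h' : j < i + 1 := by omega
      simp [hij, h']

lemma sum_range_split_two {V : Type*} [AddCommGroup V] (k m : ℕ) (f : ℕ → V) :
    ∑ j ∈ Finset.range (k + m + 2), f j =
      ∑ j ∈ Finset.range k, f j + f k + f (k + 1) + ∑ j ∈ Finset.range m, f (k + 2 + j) := by
  rw [show k + m + 2 = (k + 2) + m by omega, Finset.sum_range_add, Finset.sum_range_succ,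
    Finset.sum_range_succ]

/-- The combinatorics of a simplicial homotopy: `S j k` stands for the `j`-th face of the `k`-th
degeneracy, and `U j k` for the `k`-th degeneracy of the `j`-th face. -/
lemma sum_sum_homotopy (n : ℕ) (S U : ℕ → ℕ → V)
    (h₁ : ∀ j k, j < k → k ≤ n → S j k = U j (k - 1))
    (h₂ : ∀ j k, k + 2 ≤ j → j ≤ n + 1 → S j k = U (j - 1) k)
    (h₃ : ∀ k, k < n → S (k + 1) k = S (k + 1) (k + 1)) :
    ∑ k ∈ Finset.range (n + 1), ∑ j ∈ Finset.range (n + 2), (-1 : ℂ) ^ (j + k) • S j k +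
      ∑ k ∈ Finset.range n, ∑ j ∈ Finset.range (n + 1), (-1 : ℂ) ^ (j + k) • U j k =
    S 0 0 - S (n + 1) n := by
  have key : ∀ k ≤ n, ∑ j ∈ Finset.range (n + 2), (-1 : ℂ) ^ (j + k) • S j k =
      (S k k - S (k + 1) k) + ∑ j ∈ Finset.range k, (-1 : ℂ) ^ (j + k) • U j (k - 1)
        - ∑ j ∈ Finset.range (n - k), (-1 : ℂ) ^ (k + 1 + j + k) • U (k + 1 + j) k := by
    intro k hk
    obtain ⟨m, rfl⟩ := Nat.exists_eq_add_of_le hk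
    rw [sum_range_split_two, Nat.add_sub_cancel_left]
    have e₁ : ∑ j ∈ Finset.range k, (-1 : ℂ) ^ (j + k) • S j k =
        ∑ j ∈ Finset.range k, (-1 : ℂ) ^ (j + k) • U j (k - 1) :=
      Finset.sum_congr rfl fun j hj => by rw [h₁ j k (Finset.mem_range.1 hj) hk]
    have e₂ : ∑ j ∈ Finset.range m, (-1 : ℂ) ^ (k + 2 + j + k) • S (k + 2 + j) k =
        -∑ j ∈ Finset.range m, (-1 : ℂ) ^ (k + 1 + j + k) • U (k + 1 + j) k := by
      rw [← Finset.sum_neg_distrib]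
      refine Finset.sum_congr rfl fun j hj => ?_
      have := Finset.mem_range.1 hj
      rw [h₂ (k + 2 + j) k (by omega) (by omega), show k + 2 + j - 1 = k + 1 + j by omega,
        show k + 2 + j + k = (k + 1 + j + k) + 1 by omega, pow_succ]
      simp
    have e₃ : (-1 : ℂ) ^ (k + k) = 1 := Even.neg_one_pow ⟨k, rfl⟩
    rw [e₁, e₂, e₃, show k + 1 + k = (k + k) + 1 by omega, pow_succ, e₃]
    simp only [one_smul, one_mul, neg_smul]
    abel
  have tele : ∀ m ≤ n, ∑ k ∈ Finset.range (m + 1), (S k k - S (k + 1) k) =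
      S 0 0 - S (m + 1) m := by
    intro m
    induction m with
    | zero => intro _; simp
    | succ m ih =>
      intro hm
      rw [Finset.sum_range_succ, ih (by omega), h₃ m (by omega)]
      abel
  rw [Finset.sum_congr rfl fun k hk => key k (by have := Finset.mem_range.1 hk; omega),
    Finset.sum_sub_distrib, Finset.sum_add_distrib, tele n le_rfl, Finset.sum_range_succ'
    (fun k => ∑ j ∈ Finset.range k, (-1 : ℂ) ^ (j + k) • U j (k - 1)),
    Finset.sum_range_succ (fun k => ∑ j ∈ Finset.range (n - k),
      (-1 : ℂ) ^ (k + 1 + j + k) • U (k + 1 + j) k)]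
  have split : ∑ k ∈ Finset.range n, ∑ j ∈ Finset.range (n + 1), (-1 : ℂ) ^ (j + k) • U j k =
      -∑ k ∈ Finset.range n, ∑ j ∈ Finset.range (k + 1),
          (-1 : ℂ) ^ (j + (k + 1)) • U j (k + 1 - 1) +
        ∑ k ∈ Finset.range n, ∑ j ∈ Finset.range (n - k),
          (-1 : ℂ) ^ (k + 1 + j + k) • U (k + 1 + j) k := by
    rw [← Finset.sum_neg_distrib, ← Finset.sum_add_distrib]
    refine Finset.sum_congr rfl fun k hk => ?_
    have hk := Finset.mem_range.1 hk
    rw [show n + 1 = (k + 1) + (n - k) by omega, Finset.sum_range_add, ← Finset.sum_neg_distrib]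
    congr 1
    refine Finset.sum_congr rfl fun j _ => ?_
    rw [Nat.add_sub_cancel, ← add_assoc, pow_succ]
    simp
  rw [split]
  simp only [Finset.range_zero, Finset.sum_empty, Nat.sub_self]
  abel

end AlternatingSums

/-! ### Faces of elementary chains -/

section FaceData

variable {D Y : Type*} [Ring D] [AddCommGroup Y]

/-- The sequence `a_0, …, a_j a_{j+1}, …`. -/
def contract (j : ℕ) (a : ℕ → D) (k : ℕ) : D :=
  if k < j then a k else if k = j then a k * a (k + 1) else a (k + 1)

/-- The algebra entries of the `j`-th face of `a_0 ⊗ ⋯ ⊗ a_n ⊗ y`. -/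
def faceAlg (n j : ℕ) (a : ℕ → D) (k : ℕ) : D :=
  if j = 0 then a (k + 1) else if j = n + 1 then a k else contract (j - 1) a k

/-- The module entry of the `j`-th face of `a_0 ⊗ ⋯ ⊗ a_n ⊗ y`. -/
def faceMod [Module D Y] [Module Dᵐᵒᵖ Y] (n j : ℕ) (a : ℕ → D) (y : Y) : Y :=
  if j = 0 then MulOpposite.op (a 0) • y else if j = n + 1 then a n • y else y

lemma faceAlg_faceAlg (n : ℕ) (a : ℕ → D) {i j : ℕ} (hij : i < j) (hj : j ≤ n + 2) (k : ℕ)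
    (hk : k < n) :
    faceAlg n i (faceAlg (n + 1) j a) k = faceAlg n (j - 1) (faceAlg (n + 1) i a) k := by
  grind (splits := 25) [faceAlg, contract, mul_assoc]

lemma faceMod_faceMod [Module D Y] [Module Dᵐᵒᵖ Y] [SMulCommClass D Dᵐᵒᵖ Y] (n : ℕ) (a : ℕ → D) (y : Y) {i j : ℕ}
    (hij : i < j) (hj : j ≤ n + 2) :
    faceMod n i (faceAlg (n + 1) j a) (faceMod (n + 1) j a y) =
      faceMod n (j - 1) (faceAlg (n + 1) i a) (faceMod (n + 1) i a y) := by
  rcases Nat.eq_zero_or_pos i with rfl | hi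
  · rcases eq_or_ne j 1 with rfl | hj₁
    · simp [faceMod, faceAlg, contract, mul_smul]
    · rcases eq_or_ne j (n + 2) with rfl | hj₂
      · simp [faceMod, faceAlg, smul_comm]
      · have h₁ : j - 1 ≠ 0 := by omega
        have h₂ : j - 1 ≠ n + 1 := by omega
        have h₃ : 0 < j - 1 := by omega
        have h₄ : j ≠ 0 := by omega
        simp [faceMod, faceAlg, contract, h₁, h₂, h₃, h₄, hj₂]
  · have h₁ : i ≠ 0 := by omega
    have h₂ : j ≠ 0 := by omega
    have h₃ : j - 1 ≠ 0 := by omega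
    have h₄ : i ≠ n + 2 := by omega
    rcases eq_or_ne j (n + 2) with rfl | hj₂
    · rcases eq_or_ne i (n + 1) with rfl | hi₂
      · simp [faceMod, faceAlg, contract, mul_smul]
      · have h₅ : ¬ n < i - 1 := by omega
        have h₆ : n ≠ i - 1 := by omega
        simp [faceMod, faceAlg, contract, h₁, hi₂, h₄, h₅, h₆]
    · have h₅ : j - 1 ≠ n + 1 := by omega
      have h₆ : i ≠ n + 1 := by omega
      simp [faceMod, h₁, h₂, h₃, h₄, h₅, h₆, hj₂]

end FaceData

/-! ### Elementary chains -/

section ElementaryChains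

variable {D Y : Type u} [NormedRing D] [NormedAlgebra ℂ D] [NormedAddCommGroup Y] [NormedSpace ℂ Y]

/-- The elementary chain `a_0 ⊗ ⋯ ⊗ a_{n-1} ⊗ y`. -/
def elemChain (n : ℕ) (a : ℕ → D) (y : Y) : Chains D Y n :=
  ((pureChain (fun i : Fin n => a i) y : ⨂[ℂ] i, ChainFactor D Y n i) : Chains D Y n)

lemma elemChain_congr {n : ℕ} {a b : ℕ → D} (y : Y) (h : ∀ i < n, a i = b i) :
    elemChain n a y = elemChain n b y := by
  have : (fun i : Fin n => a i) = fun i : Fin n => b i := funext fun i => h i i.2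
  rw [elemChain, elemChain, this]

lemma elemChain_add (n : ℕ) (a : ℕ → D) (x y : Y) :
    elemChain n a (x + y) = elemChain n a x + elemChain n a y := by
  rw [elemChain, pureChain_add, UniformSpace.Completion.coe_add]
  rfl

lemma elemChain_zero (n : ℕ) (a : ℕ → D) : elemChain n a (0 : Y) = 0 := by
  simpa using elemChain_add n a (0 : Y) 0

lemma chains_hom_ext {n : ℕ} {Z : Type*} [NormedAddCommGroup Z] [NormedSpace ℂ Z]
    {f g : Chains D Y n →L[ℂ] Z}
    (h : ∀ a y, f (elemChain n a y) = g (elemChain n a y)) : f = g := by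
  have key : ((f : Chains D Y n →ₗ[ℂ] Z) ∘ₗ
        (UniformSpace.Completion.toComplL : _ →L[ℂ] Chains D Y n).toLinearMap) =
      (g : Chains D Y n →ₗ[ℂ] Z) ∘ₗ
        (UniformSpace.Completion.toComplL : _ →L[ℂ] Chains D Y n).toLinearMap := by
    refine PiTensorProduct.ext (MultilinearMap.ext fun v => ?_)
    have hv : elemChain n (fun k : ℕ => if hk : k < n then algPart v ⟨k, hk⟩ else 0) (modPart v) =
        ((PiTensorProduct.tprod ℂ v : ⨂[ℂ] i, ChainFactor D Y n i) : Chains D Y n) := by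
      have : chainTuple (fun i : Fin n => (fun k : ℕ => if hk : k < n then algPart v ⟨k, hk⟩
          else 0) i) (modPart v) = v := by
        funext i
        rcases i with _ | i
        · rfl
        · exact dif_pos i.2
      rw [elemChain, pureChain, this]
      rfl
    have key := h (fun k : ℕ => if hk : k < n then algPart v ⟨k, hk⟩ else 0) (modPart v)
    rw [hv] at key
    exact key
  ext z
  refine UniformSpace.Completion.induction_on z (isClosed_eq f.continuous g.continuous) fun z => ?_
  exact LinearMap.congr_fun key z

lemma lift_elemChain {n : ℕ} {W : Type*} [SeminormedAddCommGroup W] [NormedSpace ℂ W]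
    (f : ContinuousMultilinearMap ℂ (ChainFactor D Y n) W) (a : ℕ → D) (y : Y) :
    (PiTensorProduct.liftIsometry ℂ (ChainFactor D Y n) W f).completion (elemChain n a y) =
      ((f (chainTuple (fun i : Fin n => a i) y) : W) : UniformSpace.Completion W) := by
  rw [elemChain, ContinuousLinearMap.completion_apply_coe]
  simp [pureChain]

variable [Module D Y] [Module Dᵐᵒᵖ Y] [IsScalarTower ℂ D Y] [IsScalarTower ℂ Dᵐᵒᵖ Y]
  [ContinuousSMul D Y] [ContinuousSMul Dᵐᵒᵖ Y]

lemma boundary_elemChain (n : ℕ) (a : ℕ → D) (y : Y) :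
    boundary D Y n (elemChain (n + 1) a y) = ∑ j ∈ Finset.range (n + 2),
      (-1 : ℂ) ^ j • elemChain n (faceAlg n j a) (faceMod n j a y) := by
  rw [boundary, lift_elemChain, Finset.sum_range_succ, Finset.sum_range_succ', add_comm (∑ _ ∈ _, _),
    Finset.sum_range]
  simp only [add_apply, sum_apply, smul_apply]
  have hsum : ∀ (s : Finset (Fin n)) (g : Fin n → ⨂[ℂ] i, ChainFactor D Y n i),
      ((∑ j ∈ s, g j : ⨂[ℂ] i, ChainFactor D Y n i) : Chains D Y n) =
        ∑ j ∈ s, (g j : Chains D Y n) := fun s g =>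
    map_sum (UniformSpace.Completion.toComplL (𝕜 := ℂ) (E := ⨂[ℂ] i, ChainFactor D Y n i)) g s
  rw [UniformSpace.Completion.coe_add, UniformSpace.Completion.coe_add, hsum]
  simp only [UniformSpace.Completion.coe_smul]
  congr 1
  · congr 1
    · rw [pow_zero, one_smul]
      rfl
    · refine Finset.sum_congr rfl fun j _ => ?_
      congr 1
      have h : (j : ℕ) + 1 ≠ n + 1 := by have := j.2; omega
      simp only [faceMod, h, if_false, Nat.succ_ne_zero]
      change ((pureChain _ _ : ⨂[ℂ] i, ChainFactor D Y n i) : Chains D Y n) = _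
      rw [elemChain]
      congr 2
      funext k
      simp only [faceAlg, h, Nat.succ_ne_zero, if_false, Nat.add_sub_cancel]
      rfl
  · congr 1
    rw [show faceAlg n (n + 1) a = a from funext fun k => by simp [faceAlg]]
    simp only [faceMod, if_true, Nat.succ_ne_zero, if_false]
    rfl

lemma boundary_boundary [SMulCommClass D Dᵐᵒᵖ Y] (n : ℕ) (z : Chains D Y (n + 2)) :
    boundary D Y n (boundary D Y (n + 1) z) = 0 := by
  suffices h : boundary D Y n ∘L boundary D Y (n + 1) = 0 from DFunLike.congr_fun h z
  refine chains_hom_ext fun a y => ?_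
  rw [ContinuousLinearMap.comp_apply, boundary_elemChain, map_sum]
  simp only [map_smul, boundary_elemChain, Finset.smul_sum, smul_smul, ← pow_add]
  refine Eq.trans ?_ (sum_sum_alternating_eq_zero n (fun i j => elemChain n
    (faceAlg n i (faceAlg (n + 1) j a)) (faceMod n i (faceAlg (n + 1) j a) (faceMod (n + 1) j a y)))
    fun i j hij hj => ?_)
  · simp only [add_comm]
  · rw [faceMod_faceMod n a y hij hj]
    exact elemChain_congr _ fun k hk => faceAlg_faceAlg n a hij hj k hk

end ElementaryChains

/-! ### Chain maps -/

section ChainMap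

variable {D D' D'' Y Y' Y'' : Type u}
  [NormedRing D] [NormedAlgebra ℂ D] [NormedAddCommGroup Y] [NormedSpace ℂ Y]
  [NormedRing D'] [NormedAlgebra ℂ D'] [NormedAddCommGroup Y'] [NormedSpace ℂ Y']
  [NormedRing D''] [NormedAlgebra ℂ D''] [NormedAddCommGroup Y''] [NormedSpace ℂ Y'']

/-- The maps `φ` and `θ` on the factors of a space of chains. -/
def chainFactorMap (φ : D →L[ℂ] D') (θ : Y →L[ℂ] Y') (n : ℕ) :
    ∀ i, ChainFactor D Y n i →L[ℂ] ChainFactor D' Y' n i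
  | none => θ
  | some _ => φ

/-- The bounded operator `a_1 ⊗ ⋯ ⊗ a_n ⊗ y ↦ φ(a_1) ⊗ ⋯ ⊗ φ(a_n) ⊗ θ(y)`. -/
def chainMap (φ : D →L[ℂ] D') (θ : Y →L[ℂ] Y') (n : ℕ) : Chains D Y n →L[ℂ] Chains D' Y' n :=
  (PiTensorProduct.mapL (chainFactorMap φ θ n)).completion

lemma chainMap_elemChain (φ : D →L[ℂ] D') (θ : Y →L[ℂ] Y') (n : ℕ) (a : ℕ → D) (y : Y) :
    chainMap φ θ n (elemChain n a y) = elemChain n (fun i => φ (a i)) (θ y) := by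
  rw [chainMap, elemChain, ContinuousLinearMap.completion_apply_coe, elemChain]
  congr 1
  rw [pureChain, pureChain, PiTensorProduct.mapL_apply]
  refine (PiTensorProduct.map_tprod _ _).trans ?_
  change PiTensorProduct.tprod ℂ _ = PiTensorProduct.tprod ℂ _
  congr 1
  funext i
  rcases i with _ | i <;> rfl

lemma chainMap_chainMap (φ : D →L[ℂ] D') (θ : Y →L[ℂ] Y') (φ' : D' →L[ℂ] D'') (θ' : Y' →L[ℂ] Y'')
    (n : ℕ) (z : Chains D Y n) :
    chainMap φ' θ' n (chainMap φ θ n z) = chainMap (φ' ∘L φ) (θ' ∘L θ) n z := by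
  refine DFunLike.congr_fun (f := chainMap φ' θ' n ∘L chainMap φ θ n) (chains_hom_ext fun a y => ?_) z
  simp only [ContinuousLinearMap.comp_apply, chainMap_elemChain]

lemma chainMap_id_id (n : ℕ) (z : Chains D Y n) :
    chainMap (ContinuousLinearMap.id ℂ D) (ContinuousLinearMap.id ℂ Y) n z = z := by
  refine DFunLike.congr_fun (g := ContinuousLinearMap.id ℂ _) (chains_hom_ext fun a y => ?_) z
  simp only [chainMap_elemChain, ContinuousLinearMap.id_apply]

lemma chainMap_add_right (φ : D →L[ℂ] D') (θ η : Y →L[ℂ] Y') (n : ℕ) (z : Chains D Y n) :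
    chainMap φ (θ + η) n z = chainMap φ θ n z + chainMap φ η n z := by
  refine DFunLike.congr_fun (g := chainMap φ θ n + chainMap φ η n)
    (chains_hom_ext fun a y => ?_) z
  simp only [chainMap_elemChain, add_apply, elemChain_add]

lemma chainMap_zero_right (φ : D →L[ℂ] D') (n : ℕ) (z : Chains D Y n) :
    chainMap φ (0 : Y →L[ℂ] Y') n z = 0 := by
  refine DFunLike.congr_fun (g := 0) (chains_hom_ext fun a y => ?_) z
  simp only [chainMap_elemChain, zero_apply, elemChain_zero]

variable [Module D Y] [Module Dᵐᵒᵖ Y] [IsScalarTower ℂ D Y] [IsScalarTower ℂ Dᵐᵒᵖ Y]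
  [ContinuousSMul D Y] [ContinuousSMul Dᵐᵒᵖ Y]
  [Module D' Y'] [Module D'ᵐᵒᵖ Y'] [IsScalarTower ℂ D' Y'] [IsScalarTower ℂ D'ᵐᵒᵖ Y']
  [ContinuousSMul D' Y'] [ContinuousSMul D'ᵐᵒᵖ Y']

lemma boundary_chainMap {φ : D →L[ℂ] D'} {θ : Y →L[ℂ] Y'}
    (hφ : ∀ a b, φ (a * b) = φ a * φ b) (hl : ∀ a y, θ (a • y) = φ a • θ y)
    (hr : ∀ a y, θ (MulOpposite.op a • y) = MulOpposite.op (φ a) • θ y) (n : ℕ)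
    (z : Chains D Y (n + 1)) :
    boundary D' Y' n (chainMap φ θ (n + 1) z) = chainMap φ θ n (boundary D Y n z) := by
  refine DFunLike.congr_fun (f := boundary D' Y' n ∘L chainMap φ θ (n + 1))
    (g := chainMap φ θ n ∘L boundary D Y n) (chains_hom_ext fun a y => ?_) z
  simp only [ContinuousLinearMap.comp_apply, chainMap_elemChain, boundary_elemChain, map_sum,
    map_smul]
  refine Finset.sum_congr rfl fun j _ => ?_
  congr 2
  · funext k
    simp only [faceAlg, contract]
    split_ifs <;> simp only [hφ]
  · simp only [faceMod]
    split_ifs <;> simp only [hl, hr]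

end ChainMap

/-! ### Homotopies -/

section Homotopy

/-- The sequence `F(a_0), …, F(a_{k-1}), u, G(a_k), …`. -/
def insertSeq {D : Type*} (F G : D → D) (u : D) (k : ℕ) (a : ℕ → D) (i : ℕ) : D :=
  if i < k then F (a i) else if i = k then u else G (a (i - 1))

section Ring

variable {D : Type*} [Ring D] {F G : D → D} {u : D}

lemma faceAlg_insertSeq_of_lt (hF : ∀ s t, F (s * t) = F s * F t) {n j k : ℕ} (a : ℕ → D)
    (hjk : j < k) (hk : k ≤ n) (i : ℕ) :
    faceAlg n j (insertSeq F G u k a) i = insertSeq F G u (k - 1) (faceAlg (n - 1) j a) i := by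
  grind (splits := 25) [faceAlg, contract, insertSeq]

lemma faceAlg_insertSeq_of_add_two_le (hG : ∀ s t, G (s * t) = G s * G t) {n j k : ℕ} (a : ℕ → D)
    (hkj : k + 2 ≤ j) (hj : j ≤ n + 1) (i : ℕ) :
    faceAlg n j (insertSeq F G u k a) i = insertSeq F G u k (faceAlg (n - 1) (j - 1) a) i := by
  grind (splits := 25) [faceAlg, contract, insertSeq]

lemma faceAlg_insertSeq_succ (hu : ∀ t, F t * u = u * G t) {n k : ℕ} (a : ℕ → D)
    (hk : k < n) (i : ℕ) :
    faceAlg n (k + 1) (insertSeq F G u k a) i =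
      faceAlg n (k + 1) (insertSeq F G u (k + 1) a) i := by
  grind (splits := 25) [faceAlg, contract, insertSeq]

end Ring

variable {D Y : Type u} [NormedRing D] [NormedAlgebra ℂ D] [NormedAddCommGroup Y] [NormedSpace ℂ Y]

/-- The bounded operator
`a_0 ⊗ ⋯ ⊗ y ↦ F(a_0) ⊗ ⋯ ⊗ F(a_{k-1}) ⊗ u ⊗ G(a_k) ⊗ ⋯ ⊗ G(a_{n-1}) ⊗ θ(y)`. -/
def insertChain (F G : D →L[ℂ] D) (u : D) (θ : Y →L[ℂ] Y) (n : ℕ) (k : Fin (n + 1)) :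
    Chains D Y n →L[ℂ] Chains D Y (n + 1) :=
  (PiTensorProduct.liftIsometry ℂ (ChainFactor D Y n) _
    (faceMap
      (fun (a : Fin n → D) (i : Fin (n + 1)) => if h : (i : ℕ) < k then F (a ⟨i, by omega⟩)
        else if h' : (i : ℕ) = k then u else G (a ⟨i - 1, by omega⟩))
      (fun _ y => θ y) (fun _ => θ.toLinearMap.isLinear)
      (fun a m => Or.inl (by
        by_cases hm : (m : ℕ) < k
        · refine ⟨m.castSucc, F.toLinearMap, fun y => ⟨?_, fun _ => rfl⟩⟩
          funext i
          simp only [Function.update_apply, Fin.ext_iff, Fin.val_castSucc]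
          split_ifs <;> first | rfl | omega
        · refine ⟨m.succ, G.toLinearMap, fun y => ⟨?_, fun _ => rfl⟩⟩
          funext i
          simp only [Function.update_apply, Fin.ext_iff, Fin.val_succ]
          split_ifs <;> first | rfl | omega))
      (continuous_pi fun i => by
        split_ifs
        · exact F.continuous.comp (continuous_apply _)
        · exact continuous_const
        · exact G.continuous.comp (continuous_apply _))
      (θ.continuous.comp continuous_snd))).completion

lemma insertChain_elemChain (F G : D →L[ℂ] D) (u : D) (θ : Y →L[ℂ] Y) (n : ℕ) (k : Fin (n + 1))
    (a : ℕ → D) (y : Y) :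
    insertChain F G u θ n k (elemChain n a y) = elemChain (n + 1) (insertSeq F G u k a) (θ y) := by
  rw [insertChain, lift_elemChain]
  change ((pureChain _ _ : ⨂[ℂ] i, ChainFactor D Y (n + 1) i) : Chains D Y (n + 1)) = _
  rw [elemChain]
  congr 2

/-- The alternating sum of the operators `insertChain`. -/
def chainHomotopy (F G : D →L[ℂ] D) (u : D) (θ : Y →L[ℂ] Y) (n : ℕ) :
    Chains D Y n →L[ℂ] Chains D Y (n + 1) :=
  ∑ k : Fin (n + 1), (-1 : ℂ) ^ (k : ℕ) • insertChain F G u θ n k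

lemma chainHomotopy_elemChain (F G : D →L[ℂ] D) (u : D) (θ : Y →L[ℂ] Y) (n : ℕ)
    (a : ℕ → D) (y : Y) :
    chainHomotopy F G u θ n (elemChain n a y) = ∑ k ∈ Finset.range (n + 1),
      (-1 : ℂ) ^ k • elemChain (n + 1) (insertSeq F G u k a) (θ y) := by
  simp only [chainHomotopy, sum_apply, smul_apply, insertChain_elemChain, Finset.sum_range]

variable [Module D Y] [Module Dᵐᵒᵖ Y] [IsScalarTower ℂ D Y] [IsScalarTower ℂ Dᵐᵒᵖ Y]
  [ContinuousSMul D Y] [ContinuousSMul Dᵐᵒᵖ Y]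

variable (D Y) in
/-- An operator `h` of degree one, composed with the boundary operator; zero in degree zero. -/
def compBoundary (h : ∀ n, Chains D Y n →L[ℂ] Chains D Y (n + 1)) :
    ∀ n, Chains D Y n →L[ℂ] Chains D Y n
  | 0 => 0
  | n + 1 => h n ∘L boundary D Y n

lemma compBoundary_of_mem_cycles (h : ∀ n, Chains D Y n →L[ℂ] Chains D Y (n + 1)) {n : ℕ}
    {z : Chains D Y n} (hz : z ∈ cycles D Y n) : compBoundary D Y h n z = 0 := by
  rcases n with _ | n
  · rfl
  · have hz : boundary D Y n z = 0 := hz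
    simp [compBoundary, hz]

/-- The homotopy formula for a chain `a_0 ⊗ ⋯ ⊗ a_{n-1} ⊗ y`, in case `θ` intertwines the actions
at `y` after composing with `N`. -/
lemma chainHomotopy_formula (F G : D →L[ℂ] D) (u : D) (θ N : Y →L[ℂ] Y)
    (hF : ∀ s t, F (s * t) = F s * F t) (hG : ∀ s t, G (s * t) = G s * G t)
    (hu : ∀ t, F t * u = u * G t) (y : Y)
    (hr : ∀ t, N (MulOpposite.op (F t) • θ y) = N (θ (MulOpposite.op t • y)))
    (hl : ∀ t, N (G t • θ y) = N (θ (t • y))) (n : ℕ) (a : ℕ → D) :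
    chainMap (ContinuousLinearMap.id ℂ D) N n
        (boundary D Y n (chainHomotopy F G u θ n (elemChain n a y)) +
          compBoundary D Y (chainHomotopy F G u θ) n (elemChain n a y)) =
      elemChain n (fun i => G (a i)) (N (MulOpposite.op u • θ y)) -
        elemChain n (fun i => F (a i)) (N (u • θ y)) := by
  have key := sum_sum_homotopy n
    (fun j k => elemChain n (faceAlg n j (insertSeq F G u k a))
      (N (faceMod n j (insertSeq F G u k a) (θ y))))
    (fun j k => elemChain n (insertSeq F G u k (faceAlg (n - 1) j a))
      (N (θ (faceMod (n - 1) j a y))))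
    (fun j k hjk hk => by
      rw [elemChain_congr _ fun i _ => faceAlg_insertSeq_of_lt hF a hjk hk i]
      congr 1
      have h₁ : j ≠ n + 1 := by omega
      have h₂ : j ≠ n - 1 + 1 := by omega
      rcases eq_or_ne j 0 with rfl | h₀
      · simp [faceMod, insertSeq, hjk, hr]
      · simp [faceMod, h₀, h₁, h₂])
    (fun j k hkj hj => by
      rw [elemChain_congr _ fun i _ => faceAlg_insertSeq_of_add_two_le hG a hkj hj i]
      congr 1
      have h₀ : j ≠ 0 := by omega
      have h₁ : j - 1 ≠ 0 := by omega
      rcases eq_or_ne j (n + 1) with rfl | h₂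
      · have h₃ : ¬ n < k := by omega
        have h₄ : n ≠ k := by omega
        have h₅ : n ≠ 0 := by omega
        have h₆ : n = n - 1 + 1 := by omega
        simp [faceMod, insertSeq, h₃, h₄, h₅, ← h₆, hl]
      · have h₃ : j - 1 ≠ n - 1 + 1 := by omega
        simp [faceMod, h₀, h₁, h₂, h₃])
    (fun k hk => by
      rw [elemChain_congr _ fun i _ => faceAlg_insertSeq_succ hu a hk i]
      congr 1
      have h : k ≠ n := by omega
      simp [faceMod, h])
  have e₁ : elemChain n (faceAlg n 0 (insertSeq F G u 0 a))
      (N (faceMod n 0 (insertSeq F G u 0 a) (θ y))) =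
      elemChain n (fun i => G (a i)) (N (MulOpposite.op u • θ y)) := by
    rw [show faceMod n 0 (insertSeq F G u 0 a) (θ y) = MulOpposite.op u • θ y by
      simp [faceMod, insertSeq]]
    exact elemChain_congr _ fun i _ => by simp [faceAlg, insertSeq]
  have e₂ : elemChain n (faceAlg n (n + 1) (insertSeq F G u n a))
      (N (faceMod n (n + 1) (insertSeq F G u n a) (θ y))) =
      elemChain n (fun i => F (a i)) (N (u • θ y)) := by
    rw [show faceMod n (n + 1) (insertSeq F G u n a) (θ y) = u • θ y by
      simp [faceMod, insertSeq]]
    exact elemChain_congr _ fun i hi => by simp [faceAlg, insertSeq, hi]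
  rw [e₁, e₂] at key
  rw [← key, map_add]
  congr 1
  · rw [chainHomotopy_elemChain]
    simp only [map_sum, map_smul, boundary_elemChain, chainMap_elemChain, Finset.smul_sum,
      smul_smul, ← pow_add, ContinuousLinearMap.id_apply]
    simp only [add_comm]
  · rcases n with _ | n
    · simp [compBoundary]
    · rw [compBoundary, ContinuousLinearMap.comp_apply, boundary_elemChain, Finset.sum_comm]
      simp only [map_sum, map_smul, chainHomotopy_elemChain, chainMap_elemChain, Finset.smul_sum,
        smul_smul, ← pow_add, ContinuousLinearMap.id_apply, Nat.add_sub_cancel]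

end Homotopy

/-! ### Maps between subquotients -/

section Subquotient

variable {C C' C₁ C₂ : Type*}
  [SeminormedAddCommGroup C] [NormedSpace ℂ C] [SeminormedAddCommGroup C'] [NormedSpace ℂ C']
  [SeminormedAddCommGroup C₁] [NormedSpace ℂ C₁] [SeminormedAddCommGroup C₂] [NormedSpace ℂ C₂]
  {Z B : Submodule ℂ C} {Z' B' : Submodule ℂ C'} {Z₁ B₁ : Submodule ℂ C₁} {Z₂ B₂ : Submodule ℂ C₂}

/-- The continuous linear map of subquotients induced by a continuous linear map. -/
def subquotientMap (φ : C →L[ℂ] C') (hZ : ∀ z ∈ Z, φ z ∈ Z') (hB : ∀ z ∈ B, φ z ∈ B') :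
    (Z ⧸ B.submoduleOf Z) →L[ℂ] (Z' ⧸ B'.submoduleOf Z') :=
  (B.submoduleOf Z).liftQL
    ((B'.submoduleOf Z').mkQL ∘L (φ ∘L Z.subtypeL).codRestrict Z' fun z => hZ z z.2) fun z hz =>
    (Submodule.Quotient.mk_eq_zero (B'.submoduleOf Z')).2 (hB z hz)

/-- Continuous linear maps that exhibit `C` as the sum of `C₁` and `C₂` up to boundaries identify
the subquotients. -/
lemma nonempty_subquotient_equiv_prod (φ₁ : C →L[ℂ] C₁) (φ₂ : C →L[ℂ] C₂) (ψ₁ : C₁ →L[ℂ] C)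
    (ψ₂ : C₂ →L[ℂ] C)
    (hφ₁Z : ∀ z ∈ Z, φ₁ z ∈ Z₁) (hφ₁B : ∀ z ∈ B, φ₁ z ∈ B₁)
    (hφ₂Z : ∀ z ∈ Z, φ₂ z ∈ Z₂) (hφ₂B : ∀ z ∈ B, φ₂ z ∈ B₂)
    (hψ₁Z : ∀ z ∈ Z₁, ψ₁ z ∈ Z) (hψ₁B : ∀ z ∈ B₁, ψ₁ z ∈ B)
    (hψ₂Z : ∀ z ∈ Z₂, ψ₂ z ∈ Z) (hψ₂B : ∀ z ∈ B₂, ψ₂ z ∈ B)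
    (h₁₁ : ∀ z, φ₁ (ψ₁ z) = z) (h₂₂ : ∀ z, φ₂ (ψ₂ z) = z)
    (h₁₂ : ∀ z, φ₁ (ψ₂ z) = 0) (h₂₁ : ∀ z, φ₂ (ψ₁ z) = 0)
    (h : ∀ z ∈ Z, ψ₁ (φ₁ z) + ψ₂ (φ₂ z) - z ∈ B) :
    Nonempty ((Z ⧸ B.submoduleOf Z) ≃L[ℂ]
      (Z₁ ⧸ B₁.submoduleOf Z₁) × (Z₂ ⧸ B₂.submoduleOf Z₂)) := by
  refine ⟨ContinuousLinearEquiv.equivOfInverse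
    ((subquotientMap φ₁ hφ₁Z hφ₁B).prod (subquotientMap φ₂ hφ₂Z hφ₂B))
    ((subquotientMap ψ₁ hψ₁Z hψ₁B).coprod (subquotientMap ψ₂ hψ₂Z hψ₂B)) ?_ ?_⟩
  · intro z
    obtain ⟨z, rfl⟩ := Submodule.Quotient.mk_surjective _ z
    exact (Submodule.Quotient.eq _).2 (h z z.2)
  · rintro ⟨z₁, z₂⟩
    obtain ⟨z₁, rfl⟩ := Submodule.Quotient.mk_surjective _ z₁
    obtain ⟨z₂, rfl⟩ := Submodule.Quotient.mk_surjective _ z₂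
    refine Prod.ext ?_ ?_
    · change Submodule.Quotient.mk (p := B₁.submoduleOf Z₁) ⟨φ₁ (ψ₁ z₁ + ψ₂ z₂), _⟩ = _
      congr 1
      exact Subtype.ext (show φ₁ (ψ₁ z₁ + ψ₂ z₂) = z₁ by rw [map_add, h₁₁, h₁₂, add_zero])
    · change Submodule.Quotient.mk (p := B₂.submoduleOf Z₂) ⟨φ₂ (ψ₁ z₁ + ψ₂ z₂), _⟩ = _
      congr 1
      exact Subtype.ext (show φ₂ (ψ₁ z₁ + ψ₂ z₂) = z₂ by rw [map_add, h₂₁, h₂₂, zero_add])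

end Subquotient

section ChainMapCycles

variable {D D' Y Y' : Type u}
  [NormedRing D] [NormedAlgebra ℂ D] [NormedAddCommGroup Y] [NormedSpace ℂ Y]
  [NormedRing D'] [NormedAlgebra ℂ D'] [NormedAddCommGroup Y'] [NormedSpace ℂ Y']
  [Module D Y] [Module Dᵐᵒᵖ Y] [IsScalarTower ℂ D Y] [IsScalarTower ℂ Dᵐᵒᵖ Y]
  [ContinuousSMul D Y] [ContinuousSMul Dᵐᵒᵖ Y]
  [Module D' Y'] [Module D'ᵐᵒᵖ Y'] [IsScalarTower ℂ D' Y'] [IsScalarTower ℂ D'ᵐᵒᵖ Y']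
  [ContinuousSMul D' Y'] [ContinuousSMul D'ᵐᵒᵖ Y']
  {φ : D →L[ℂ] D'} {θ : Y →L[ℂ] Y'}

lemma chainMap_mem_cycles
    (hφ : ∀ a b, φ (a * b) = φ a * φ b) (hl : ∀ a y, θ (a • y) = φ a • θ y)
    (hr : ∀ a y, θ (MulOpposite.op a • y) = MulOpposite.op (φ a) • θ y) {n : ℕ}
    {z : Chains D Y n} (hz : z ∈ cycles D Y n) : chainMap φ θ n z ∈ cycles D' Y' n := by
  rcases n with _ | n
  · exact Submodule.mem_top
  · have hz : boundary D Y n z = 0 := hz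
    change boundary D' Y' n _ = 0
    rw [boundary_chainMap hφ hl hr, hz, map_zero]

lemma chainMap_mem_boundaries
    (hφ : ∀ a b, φ (a * b) = φ a * φ b) (hl : ∀ a y, θ (a • y) = φ a • θ y)
    (hr : ∀ a y, θ (MulOpposite.op a • y) = MulOpposite.op (φ a) • θ y) {n : ℕ}
    {z : Chains D Y n} (hz : z ∈ boundaries D Y n) : chainMap φ θ n z ∈ boundaries D' Y' n := by
  obtain ⟨w, rfl⟩ := hz
  exact ⟨chainMap φ θ (n + 1) w, boundary_chainMap hφ hl hr n w⟩

lemma boundaries_le_cycles [SMulCommClass D Dᵐᵒᵖ Y] (n : ℕ) :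
    boundaries D Y n ≤ cycles D Y n := by
  rcases n with _ | n
  · exact le_top
  · rintro _ ⟨w, rfl⟩
    exact boundary_boundary n w

end ChainMapCycles

/-! ### Upper triangular decompositions of the unit -/

section Actions

variable {T X : Type*} [NormedRing T] [NormedAlgebra ℂ T]
    [NormedAddCommGroup X] [NormedSpace ℂ X] [Module T X] [Module Tᵐᵒᵖ X]
    [IsScalarTower ℂ T X] [IsScalarTower ℂ Tᵐᵒᵖ X] [ContinuousSMul T X] [ContinuousSMul Tᵐᵒᵖ X]

variable (X) in
/-- The map `x ↦ p x q`. -/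
def compress (p q : T) : X →L[ℂ] X where
  toFun x := p • MulOpposite.op q • x
  map_add' x y := by rw [smul_add, smul_add]
  map_smul' c x := by rw [smul_comm _ c, smul_comm _ c, RingHom.id_apply]
  cont := (continuous_id.const_smul (MulOpposite.op q)).const_smul p

lemma compress_apply (p q : T) (x : X) : compress X p q x = p • MulOpposite.op q • x := rfl

end Actions

/-- Elements `e, f` with `e + f = 1`, `f T e = 0` and `f X e = 0`. -/
structure IsTriangularPair {T : Type*} (X : Type*) [Ring T] [AddCommGroup X] [Module T X]
    [Module Tᵐᵒᵖ X] (e f : T) : Prop where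
  add_eq_one : e + f = 1
  mul_mul_eq_zero : ∀ t, f * t * e = 0
  smul_smul_eq_zero : ∀ x : X, f • MulOpposite.op e • x = 0

namespace IsTriangularPair

open MulOpposite

section Ring

variable {T X : Type*} [Ring T] [AddCommGroup X] [Module T X] [Module Tᵐᵒᵖ X] {e f : T}

lemma left_mul_mul (h : IsTriangularPair X e f) (t : T) : e * (t * e) = t * e := by
  have h₁ : (e + f) * (t * e) = t * e := by rw [h.add_eq_one, one_mul]
  rwa [add_mul, ← mul_assoc f, h.mul_mul_eq_zero, add_zero] at h₁

lemma right_mul_mul (h : IsTriangularPair X e f) (t : T) : f * (t * f) = f * t := by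
  have h₁ : f * t * (e + f) = f * t := by rw [h.add_eq_one, mul_one]
  rwa [mul_add, h.mul_mul_eq_zero, zero_add, mul_assoc] at h₁

lemma left_mul_self (h : IsTriangularPair X e f) : e * e = e := by
  simpa using h.left_mul_mul 1

lemma right_mul_self (h : IsTriangularPair X e f) : f * f = f := by
  simpa using h.right_mul_mul 1

lemma right_mul_left (h : IsTriangularPair X e f) : f * e = 0 := by
  simpa using h.mul_mul_eq_zero 1

lemma left_smul_op_smul (h : IsTriangularPair X e f) (x : X) : e • op e • x = op e • x := by
  have h₁ := h.smul_smul_eq_zero x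
  have h₂ : (e + f) • op e • x = op e • x := by rw [h.add_eq_one, one_smul]
  rwa [add_smul, h₁, add_zero] at h₂

lemma right_smul_op_smul [SMulCommClass T Tᵐᵒᵖ X] (h : IsTriangularPair X e f) (x : X) :
    f • op f • x = f • x := by
  have h₁ := h.smul_smul_eq_zero x
  have h₂ : f • op (e + f) • x = f • x := by rw [h.add_eq_one, op_one, one_smul]
  rwa [op_add, add_smul, smul_add, h₁, zero_add] at h₂

lemma op_smul_smul [SMulCommClass T Tᵐᵒᵖ X] (s t : T) (x : X) : op s • t • x = t • op s • x := (smul_comm _ _ _).symm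

lemma left_map_mul {γ : T → T} (h : IsTriangularPair X e f) (hγ : ∀ t, γ t = t * e) (s t : T) :
    γ (s * t) = γ s * γ t := by
  rw [hγ, hγ, hγ, mul_assoc s e, h.left_mul_mul, mul_assoc]

lemma right_map_mul {γ : T → T} (h : IsTriangularPair X e f) (hγ : ∀ t, γ t = f * t) (s t : T) :
    γ (s * t) = γ s * γ t := by
  rw [hγ, hγ, hγ, ← mul_assoc, ← mul_assoc, mul_assoc f s f, h.right_mul_mul]

end Ring

variable {T X : Type u} [NormedRing T] [NormedAlgebra ℂ T]
    [NormedAddCommGroup X] [NormedSpace ℂ X] [Module T X] [Module Tᵐᵒᵖ X]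
    [IsScalarTower ℂ T X] [IsScalarTower ℂ Tᵐᵒᵖ X] [ContinuousSMul T X] [ContinuousSMul Tᵐᵒᵖ X]
    {e f : T} {α β : T →L[ℂ] T}

lemma right_homotopy (h : IsTriangularPair X e f) (hβ : ∀ t, β t = f * t) (n : ℕ)
    (z : Chains T X n) (hz : chainMap (ContinuousLinearMap.id ℂ T) (compress X 1 f) n z = z) :
    boundary T X n (chainHomotopy β (ContinuousLinearMap.id ℂ T) f (ContinuousLinearMap.id ℂ X) n z)
      + compBoundary T X
        (chainHomotopy β (ContinuousLinearMap.id ℂ T) f (ContinuousLinearMap.id ℂ X)) n z =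
      z - chainMap β (compress X f f) n z := by
  suffices key : (boundary T X n ∘L
        chainHomotopy β (ContinuousLinearMap.id ℂ T) f (ContinuousLinearMap.id ℂ X) n +
      compBoundary T X
        (chainHomotopy β (ContinuousLinearMap.id ℂ T) f (ContinuousLinearMap.id ℂ X)) n) ∘L
        chainMap (ContinuousLinearMap.id ℂ T) (compress X 1 f) n =
      chainMap (ContinuousLinearMap.id ℂ T) (compress X 1 f) n -
        chainMap β (compress X f f) n by
    have h' := DFunLike.congr_fun key z
    rw [ContinuousLinearMap.comp_apply, sub_apply, hz] at h'
    exact h'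
  refine chains_hom_ext fun a x => ?_
  rw [ContinuousLinearMap.comp_apply, chainMap_elemChain]
  have h' := chainHomotopy_formula β (ContinuousLinearMap.id ℂ T) f (ContinuousLinearMap.id ℂ X)
    (ContinuousLinearMap.id ℂ X) (h.right_map_mul hβ) (fun _ _ => rfl)
    (fun t => by rw [hβ, mul_assoc, h.right_mul_mul, ContinuousLinearMap.id_apply])
    (compress X 1 f x) (fun t => by
      simp only [ContinuousLinearMap.id_apply, compress_apply, hβ, one_smul, smul_smul, ← op_mul,
        ← mul_assoc, h.right_mul_self])
    (fun t => rfl) n a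
  rw [chainMap_id_id] at h'
  refine h'.trans ?_
  rw [sub_apply, chainMap_elemChain, chainMap_elemChain]
  congr 2 <;> simp only [ContinuousLinearMap.id_apply, compress_apply, one_smul, smul_smul,
    ← op_mul, h.right_mul_self]

variable [SMulCommClass T Tᵐᵒᵖ X]

lemma compress_left_smul (h : IsTriangularPair X e f) (hα : ∀ t, α t = t * e) (t : T) (x : X) :
    compress X e e (t • x) = α t • compress X e e x := by
  have h₁ : (e * t) • op e • x = (t * e) • op e • x := by
    rw [← h.left_smul_op_smul x, smul_smul, smul_smul, mul_assoc, h.left_mul_mul, mul_assoc,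
      h.left_mul_self]
  simp only [compress_apply, op_smul_smul, hα, smul_smul]
  rw [h₁, mul_assoc, h.left_mul_self]

lemma compress_left_op_smul (h : IsTriangularPair X e f) (hα : ∀ t, α t = t * e) (t : T) (x : X) :
    compress X e e (op t • x) = op (α t) • compress X e e x := by
  simp only [compress_apply, op_smul_smul, hα, smul_smul, ← op_mul, h.left_mul_mul]

lemma compress_right_smul (h : IsTriangularPair X e f) (hβ : ∀ t, β t = f * t) (t : T) (x : X) :
    compress X f f (t • x) = β t • compress X f f x := by
  simp only [compress_apply, op_smul_smul, hβ, smul_smul, mul_assoc, h.right_mul_mul]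

lemma compress_right_op_smul (h : IsTriangularPair X e f) (hβ : ∀ t, β t = f * t) (t : T)
    (x : X) : compress X f f (op t • x) = op (β t) • compress X f f x := by
  have h₁ : f • op (t * f) • x = f • op (f * t) • x := by
    rw [← op_smul_smul, ← h.right_smul_op_smul x, op_smul_smul, smul_smul, ← op_mul,
      h.right_mul_mul]
  simp only [compress_apply, op_smul_smul, hβ, smul_smul, ← op_mul]
  rw [h₁, ← mul_assoc, h.right_mul_self]

lemma left_homotopy (h : IsTriangularPair X e f) (hα : ∀ t, α t = t * e) (n : ℕ)
    (z : Chains T X n) :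
    chainMap (ContinuousLinearMap.id ℂ T) (compress X 1 e) n
        (boundary T X n (chainHomotopy (ContinuousLinearMap.id ℂ T) α e (compress X e e) n z) +
          compBoundary T X (chainHomotopy (ContinuousLinearMap.id ℂ T) α e (compress X e e)) n z) =
      chainMap α (compress X e e) n z -
        chainMap (ContinuousLinearMap.id ℂ T) (compress X 1 e) n z := by
  refine DFunLike.congr_fun (f := chainMap (ContinuousLinearMap.id ℂ T) (compress X 1 e) n ∘L
        (boundary T X n ∘L chainHomotopy (ContinuousLinearMap.id ℂ T) α e (compress X e e) n +
          compBoundary T X (chainHomotopy (ContinuousLinearMap.id ℂ T) α e (compress X e e)) n))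
    (g := chainMap α (compress X e e) n -
        chainMap (ContinuousLinearMap.id ℂ T) (compress X 1 e) n) (chains_hom_ext fun a x => ?_) z
  refine (chainHomotopy_formula (ContinuousLinearMap.id ℂ T) α e (compress X e e)
    (compress X 1 e) (fun _ _ => rfl) (h.left_map_mul hα)
    (fun t => by rw [hα, h.left_mul_mul, ContinuousLinearMap.id_apply]) x (fun t => ?_)
    (fun t => ?_) n a).trans ?_
  · simp only [ContinuousLinearMap.id_apply, compress_apply, op_smul_smul, smul_smul,
      ← op_mul, mul_assoc, h.left_mul_self, h.left_mul_mul]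
  · rw [h.compress_left_smul hα]
  · rw [sub_apply, chainMap_elemChain, chainMap_elemChain]
    congr 2 <;> simp only [compress_apply, one_smul, smul_smul, ← op_mul,
      h.left_mul_self, h.left_smul_op_smul]

/-- A cycle is homologous to the sum of its diagonal parts. -/
lemma add_sub_mem_boundaries (h : IsTriangularPair X e f) (hα : ∀ t, α t = t * e)
    (hβ : ∀ t, β t = f * t) {n : ℕ} {z : Chains T X n} (hz : z ∈ cycles T X n) :
    chainMap α (compress X e e) n z + chainMap β (compress X f f) n z - z ∈
      boundaries T X n := by
  have hA := h.left_homotopy hα n z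
  rw [compBoundary_of_mem_cycles _ hz, add_zero] at hA
  set w := chainHomotopy (ContinuousLinearMap.id ℂ T) α e (compress X e e) n z
  set z' := z + boundary T X n w - chainMap α (compress X e e) n z with hz'
  have hid : ∀ y : Chains T X n, chainMap (ContinuousLinearMap.id ℂ T) (compress X 1 e) n y +
      chainMap (ContinuousLinearMap.id ℂ T) (compress X 1 f) n y = y := fun y => by
    rw [← chainMap_add_right]
    convert chainMap_id_id n y
    ext x
    simp only [add_apply, compress_apply, one_smul, ← add_smul, ← op_add, h.add_eq_one, op_one,
      ContinuousLinearMap.id_apply]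
  have hE : chainMap (ContinuousLinearMap.id ℂ T) (compress X 1 e) n z' = 0 := by
    have h₁ : (compress X (1 : T) e) ∘L compress X e e = compress X e e := by
      ext x
      simp only [ContinuousLinearMap.comp_apply, compress_apply, op_smul_smul, smul_smul,
        ← op_mul, h.left_mul_self, one_mul]
    rw [hz', map_sub, map_add, hA, chainMap_chainMap, h₁, ContinuousLinearMap.id_comp]
    abel
  have hcyc : z' ∈ cycles T X n :=
    sub_mem (add_mem hz (boundaries_le_cycles n ⟨w, rfl⟩)) (chainMap_mem_cycles
      (h.left_map_mul hα) (h.compress_left_smul hα) (h.compress_left_op_smul hα) hz)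
  have hE' : chainMap (ContinuousLinearMap.id ℂ T) (compress X 1 f) n z' = z' := by
    simpa only [hE, zero_add] using hid z'
  have hB := h.right_homotopy hβ n z' hE'
  rw [compBoundary_of_mem_cycles _ hcyc, add_zero] at hB
  have hBA : chainMap β (compress X f f) n (chainMap α (compress X e e) n z) = 0 := by
    have h₁ : compress X f f ∘L compress X e e = 0 := by
      ext x
      simp only [ContinuousLinearMap.comp_apply, compress_apply, op_smul_smul, smul_smul,
        h.right_mul_left, zero_smul, zero_apply]
    rw [chainMap_chainMap, h₁, chainMap_zero_right]
  have hB' : chainMap β (compress X f f) n z' = chainMap β (compress X f f) n z +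
      boundary T X n (chainMap β (compress X f f) (n + 1) w) := by
    rw [hz', map_sub, map_add, hBA, sub_zero, boundary_chainMap (h.right_map_mul hβ)
      (h.compress_right_smul hβ) (h.compress_right_op_smul hβ)]
  rw [hB'] at hB
  refine ⟨w - chainHomotopy β (ContinuousLinearMap.id ℂ T) f (ContinuousLinearMap.id ℂ X) n z' -
    chainMap β (compress X f f) (n + 1) w, ?_⟩
  change boundary T X n _ = _
  rw [map_sub, map_sub, hB, hz']
  abel

end IsTriangularPair

/-! ### The corners of a triangular algebra and of a bimodule over it -/

namespace TriangularAlgebra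

section CornerMaps

variable (A M B : Type*)
  [NormedRing A] [NormedAlgebra ℂ A] [NormedRing B] [NormedAlgebra ℂ B]
  [NormedAddCommGroup M] [NormedSpace ℂ M] [Module A M] [Module Bᵐᵒᵖ M]
  [SMulCommClass A Bᵐᵒᵖ M]

/-- The inclusion of `A`, as a continuous linear map. -/
def inclAL : A →L[ℂ] TriangularAlgebra A M B :=
  ⟨(inclA A M B : A →ₗ[ℂ] TriangularAlgebra A M B), continuous_inclA A M B⟩

/-- The inclusion of `B`, as a continuous linear map. -/
def inclBL : B →L[ℂ] TriangularAlgebra A M B :=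
  ⟨(inclB A M B : B →ₗ[ℂ] TriangularAlgebra A M B), continuous_inclB A M B⟩

/-- The projection onto `A`. -/
def projA : TriangularAlgebra A M B →L[ℂ] A :=
  LinearMap.mkContinuous ⟨⟨fun t => t.a, fun _ _ => rfl⟩, fun _ _ => rfl⟩ 1 fun t => by
    change ‖t.a‖ ≤ 1 * ‖t‖
    rw [norm_def]
    linarith [norm_nonneg t.m, norm_nonneg t.b]

/-- The projection onto `B`. -/
def projB : TriangularAlgebra A M B →L[ℂ] B :=
  LinearMap.mkContinuous ⟨⟨fun t => t.b, fun _ _ => rfl⟩, fun _ _ => rfl⟩ 1 fun t => by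
    change ‖t.b‖ ≤ 1 * ‖t‖
    rw [norm_def]
    linarith [norm_nonneg t.m, norm_nonneg t.a]

variable {A M B}

lemma inclA_one_add_inclB_one : inclA A M B 1 + inclB A M B 1 = 1 := by
  ext <;> simp [inclA, inclB]

lemma inclA_mul_inclB (a : A) (b : B) : inclA A M B a * inclB A M B b = 0 := by
  ext <;> simp [inclA, inclB]

lemma inclB_mul_inclA (b : B) (a : A) : inclB A M B b * inclA A M B a = 0 := by
  ext <;> simp [inclA, inclB]

lemma mul_inclA_one (t : TriangularAlgebra A M B) : t * inclA A M B 1 = inclA A M B t.a := by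
  ext <;> simp [inclA]

lemma inclB_one_mul (t : TriangularAlgebra A M B) : inclB A M B 1 * t = inclB A M B t.b := by
  ext <;> simp [inclB]

end CornerMaps

section Bimodule

variable (A M B X : Type*)
  [NormedRing A] [NormedAlgebra ℂ A] [NormedRing B] [NormedAlgebra ℂ B]
  [NormedAddCommGroup M] [NormedSpace ℂ M] [Module A M] [Module Bᵐᵒᵖ M]
  [SMulCommClass A Bᵐᵒᵖ M] [IsScalarTower ℂ A M] [IsScalarTower ℂ Bᵐᵒᵖ M]
  [IsBoundedSMul A M] [IsBoundedSMul Bᵐᵒᵖ M]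
  [NormedAddCommGroup X] [NormedSpace ℂ X]
  [Module (TriangularAlgebra A M B) X] [Module (TriangularAlgebra A M B)ᵐᵒᵖ X]
  [IsScalarTower ℂ (TriangularAlgebra A M B) X]
  [IsScalarTower ℂ (TriangularAlgebra A M B)ᵐᵒᵖ X]

variable {A M B X} in
lemma isTriangularPair (hX : cornerBA A M B X = ⊥) :
    IsTriangularPair X (inclA A M B 1) (inclB A M B 1) where
  add_eq_one := inclA_one_add_inclB_one
  mul_mul_eq_zero t := by rw [inclB_one_mul]; exact inclB_mul_inclA _ _
  smul_smul_eq_zero x := by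
    have h : inclB A M B 1 • MulOpposite.op (inclA A M B 1) • x ∈ cornerBA A M B X := ⟨x, rfl⟩
    rwa [hX, Submodule.mem_bot] at h

variable [ContinuousSMul (TriangularAlgebra A M B) X]
  [ContinuousSMul (TriangularAlgebra A M B)ᵐᵒᵖ X]

/-- The map `x ↦ 1_A x 1_A` onto the corner `X_AA`. -/
def cornerProjA : X →L[ℂ] cornerAA A M B X :=
  (compress X (inclA A M B 1) (inclA A M B 1)).codRestrict (cornerAA A M B X) fun x => ⟨x, rfl⟩

/-- The map `x ↦ 1_B x 1_B` onto the corner `X_BB`. -/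
def cornerProjB : X →L[ℂ] cornerBB A M B X :=
  (compress X (inclB A M B 1) (inclB A M B 1)).codRestrict (cornerBB A M B X) fun x => ⟨x, rfl⟩

end Bimodule

end TriangularAlgebra

end

open TriangularAlgebra in
theorem theorem3p3 (A B M X : Type u)
    [NormedRing A] [NormedAlgebra ℂ A] [CompleteSpace A]
    [NormedRing B] [NormedAlgebra ℂ B] [CompleteSpace B]
    [NormedAddCommGroup M] [NormedSpace ℂ M] [CompleteSpace M]
    [Module A M] [Module Bᵐᵒᵖ M] [SMulCommClass A Bᵐᵒᵖ M]
    [IsScalarTower ℂ A M] [IsScalarTower ℂ Bᵐᵒᵖ M]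
    [IsBoundedSMul A M] [IsBoundedSMul Bᵐᵒᵖ M]
    [NormedAddCommGroup X] [NormedSpace ℂ X] [CompleteSpace X]
    [Module (TriangularAlgebra A M B) X] [Module (TriangularAlgebra A M B)ᵐᵒᵖ X]
    [SMulCommClass (TriangularAlgebra A M B) (TriangularAlgebra A M B)ᵐᵒᵖ X]
    [IsScalarTower ℂ (TriangularAlgebra A M B) X]
    [IsScalarTower ℂ (TriangularAlgebra A M B)ᵐᵒᵖ X]
    [ContinuousSMul (TriangularAlgebra A M B) X]
    [ContinuousSMul (TriangularAlgebra A M B)ᵐᵒᵖ X]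
    (hX : cornerBA A M B X = ⊥) (n : ℕ) :
    Nonempty (BanachHomology (TriangularAlgebra A M B) X n ≃L[ℂ]
      BanachHomology A (cornerAA A M B X) n × BanachHomology B (cornerBB A M B X) n) := by
  have h := isTriangularPair hX
  have hα : ∀ t, (inclAL A M B ∘L projA A M B) t = t * inclA A M B 1 :=
    fun t => (mul_inclA_one t).symm
  have hβ : ∀ t, (inclBL A M B ∘L projB A M B) t = inclB A M B 1 * t :=
    fun t => (inclB_one_mul t).symm
  have eA : ∀ s t, projA A M B (s * t) = projA A M B s * projA A M B t := fun _ _ => rfl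
  have eB : ∀ s t, projB A M B (s * t) = projB A M B s * projB A M B t := fun _ _ => rfl
  have lA : ∀ t x, cornerProjA A M B X (t • x) = projA A M B t • cornerProjA A M B X x :=
    fun t x => Subtype.ext (h.compress_left_smul hα t x)
  have rA : ∀ t x, cornerProjA A M B X (MulOpposite.op t • x) =
      MulOpposite.op (projA A M B t) • cornerProjA A M B X x :=
    fun t x => Subtype.ext (h.compress_left_op_smul hα t x)
  have lB : ∀ t x, cornerProjB A M B X (t • x) = projB A M B t • cornerProjB A M B X x :=
    fun t x => Subtype.ext (h.compress_right_smul hβ t x)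
  have rB : ∀ t x, cornerProjB A M B X (MulOpposite.op t • x) =
      MulOpposite.op (projB A M B t) • cornerProjB A M B X x :=
    fun t x => Subtype.ext (h.compress_right_op_smul hβ t x)
  have jA : ∀ a a', inclAL A M B (a * a') = inclAL A M B a * inclAL A M B a' :=
    map_mul (inclA A M B)
  have jB : ∀ b b', inclBL A M B (b * b') = inclBL A M B b * inclBL A M B b' :=
    map_mul (inclB A M B)
  have pAA : cornerProjA A M B X ∘L (cornerAA A M B X).subtypeL = ContinuousLinearMap.id ℂ _ := by
    ext x
    exact (congrArg (inclA A M B 1 • ·) (cornerSpace_op_one_smul (inclA A M B) x.2)).trans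
      (cornerSpace_one_smul (inclA A M B) x.2)
  have pBB : cornerProjB A M B X ∘L (cornerBB A M B X).subtypeL = ContinuousLinearMap.id ℂ _ := by
    ext x
    exact (congrArg (inclB A M B 1 • ·) (cornerSpace_op_one_smul (inclB A M B) x.2)).trans
      (cornerSpace_one_smul (inclB A M B) x.2)
  have pAB : cornerProjA A M B X ∘L (cornerBB A M B X).subtypeL = 0 := by
    ext x
    change inclA A M B 1 • MulOpposite.op (inclA A M B 1) • (x : X) = 0
    rw [← cornerSpace_one_smul (inclB A M B) x.2, IsTriangularPair.op_smul_smul, smul_smul,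
      inclA_mul_inclB, zero_smul]
  have pBA : cornerProjB A M B X ∘L (cornerAA A M B X).subtypeL = 0 := by
    ext x
    change inclB A M B 1 • MulOpposite.op (inclB A M B 1) • (x : X) = 0
    rw [← cornerSpace_one_smul (inclA A M B) x.2, IsTriangularPair.op_smul_smul, smul_smul,
      inclB_mul_inclA, zero_smul]
  refine nonempty_subquotient_equiv_prod
    (chainMap (projA A M B) (cornerProjA A M B X) n)
    (chainMap (projB A M B) (cornerProjB A M B X) n)
    (chainMap (inclAL A M B) (cornerAA A M B X).subtypeL n)
    (chainMap (inclBL A M B) (cornerBB A M B X).subtypeL n)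
    (fun _ => chainMap_mem_cycles eA lA rA) (fun _ => chainMap_mem_boundaries eA lA rA)
    (fun _ => chainMap_mem_cycles eB lB rB) (fun _ => chainMap_mem_boundaries eB lB rB)
    (fun _ => chainMap_mem_cycles jA (fun _ _ => rfl) (fun _ _ => rfl))
    (fun _ => chainMap_mem_boundaries jA (fun _ _ => rfl) (fun _ _ => rfl))
    (fun _ => chainMap_mem_cycles jB (fun _ _ => rfl) (fun _ _ => rfl))
    (fun _ => chainMap_mem_boundaries jB (fun _ _ => rfl) (fun _ _ => rfl))
    (fun z => ?_) (fun z => ?_) (fun z => ?_) (fun z => ?_) (fun z hz => ?_)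
  · rw [chainMap_chainMap, pAA]
    exact chainMap_id_id n z
  · rw [chainMap_chainMap, pBB]
    exact chainMap_id_id n z
  · rw [chainMap_chainMap, pAB, chainMap_zero_right]
  · rw [chainMap_chainMap, pBA, chainMap_zero_right]
  · rw [chainMap_chainMap, chainMap_chainMap]
    exact h.add_sub_mem_boundaries hα hβ hz
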